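/- Let $n\ge1$ and $m,q,r,p\ge0$ be integers. Consider a system of $q$ equations $\Delta^\nu(\mathbf x,\mathbf u^{(r)};\varepsilon)=0$ ($\nu=1,\dots,q$), where $\mathbf x\in\mathbb R^n$, $\mathbf u$ has $m$ components, $\mathbf u^{(r)}$ denotes $\mathbf u$ together with all its derivatives up to order $r$, and the functions $\Delta^\nu$ are $C^\infty$ for $(\mathbf x,\mathbf u^{(r)})$ in an open set $D$ of the $r$-jet space and $\varepsilon$ near $0$ (i.e. on a neighbourhood of $D\times\{0\}$). For a function $f(\mathbf x,\mathbf u^{(s)};\varepsilon)$ let $\widetilde f_{(k)}$ be the coefficient of $\varepsilon^k$ in the expansion of $f\big(\mathbf x,\sum_{j=0}^p\varepsilon^j\mathbf u^{(s)}_{(j)};\varepsilon\big)$ in powers of $\varepsilon$ $(0\le k\le p)$. Let $$D_i=\frac{\partial}{\partial x_i}+\sum_{k=0}^p\sum_{\alpha=1}^m\sum_J u_{(k)\alpha,Ji}\frac{\partial}{\partial u_{(k)\alpha,J}},\qquad E_{u_{(0)\alpha}}=\sum_{|J|\le r}(-1)^{|J|}D^J\frac{\partial}{\partial u_{(0)\alpha,J}},$$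 where $J=(j_1,\dots,j_n)$ runs over multi-indices, $u_{(k)\alpha,J}$ is the corresponding derivative of $u_{(k)\alpha}$, and $D^J=D_1^{j_1}\cdots D_n^{j_n}$. The solutions of the approximate system are the smooth $(\mathbf u_{(0)},\dots,\mathbf u_{(p)})$ on open subsets of $\mathbb R^n$, with the $r$-jets of $\mathbf u_{(0)}$ in $D$, such that $\sum_{k=0}^p\varepsilon^k\widetilde\Delta^\nu_{(k)}=O(\varepsilon^{p+1})$ for all $\nu$. Let $\Lambda^\nu(\mathbf x,\mathbf u^{(r)};\varepsilon)$ ($\nu=1,\dots,q$) be functions that are $C^\infty$ on a neighbourhood of $W\times\{0\}$, where $W\subseteq D$ is open, and that are non-singular on solutions: the $r$-jets of $\mathbf u_{(0)}$ lie in $W$ for every solution of the approximate system. We say that $\{\Lambda^\nu\}$ yields an approximate conservation law on $W$ if there are fluxes $\Phi^i(\mathbf x,\mathbf u^{(s)};\varepsilon)$ ($i=1,\dots,n$) of some finite order $s\ge r$, $C^\infty$ near $\varepsilon=0$ at all $s$-jets over $W$, such that $$\sum_{k=0}^p\varepsilon^k\Big(\sum_{\ell=0}^k\sum_{\nu=1}^q\widetilde\Lambda^\nu_{(\ell)}\widetilde\Delta^\nu_{(k-\ell)}-\sum_{i=1}^nD_i\widetilde\Phi^i_{(k)}\Big)=O(\varepsilon^{p+1})$$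 for arbitrary smooth $\mathbf u_{(k)}(\mathbf x)$ (with the $r$-jets of $\mathbf u_{(0)}$ in $W$), and $\sum_{k=0}^p\varepsilon^k\sum_{i=1}^nD_i\widetilde\Phi^i_{(k)}=O(\varepsilon^{p+1})$ on all solutions of the approximate system. We say that it does so locally if every point of $W$ has an open neighbourhood $W'\subseteq W$ such that this holds with $D$ and $W$ replaced by $W'$. Then the condition $$E_{u_{(0)\alpha}}\Big(\sum_{k=0}^p\varepsilon^k\sum_{\ell=0}^k\sum_{\nu=1}^q\widetilde\Lambda^\nu_{(\ell)}\widetilde\Delta^\nu_{(k-\ell)}\Big)=O(\varepsilon^{p+1}),\qquad\alpha=1,\dots,m,$$ for arbitrary smooth $\mathbf u_{(k)}(\mathbf x)$, $k=0,\dots,p$ (with the $r$-jets of $\mathbf u_{(0)}$ in $W$), holds if and only if $\{\Lambda^\nu\}$ locally yields an approximate conservation law. Moreover, if the projection of $W$ to the $\mathbf x$-space is star-shaped and there is a smooth map $\mathbf u^0$ on it such that each fibre of $W$ over a point $\mathbf x$ is star-shaped about the $r$-jet of $\mathbf u^0$ at $\mathbf x$ (for instance if $W$ is the whole $r$-jet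 space), then the condition holds if and only if $\{\Lambda^\nu\}$ yields an approximate conservation law on $W$. -/

import Mathlib

open Set Filter Topology Asymptotics
open scoped ContDiff Nat

noncomputable section

namespace ApproxCL

/-- Multi-indices `J = (j₁,…,jₙ)` with `|J| ≤ r`. -/
abbrev MultiIndex (n r : ℕ) : Type := {J : Fin n → ℕ // ∑ i, J i ≤ r}

instance multiIndexFinite (n r : ℕ) : Finite (MultiIndex n r) := by
  have h : Finite {J : Fin n → ℕ // J ∈ Set.Iic (fun _ : Fin n => r)} :=
    (Set.finite_Iic (fun _ : Fin n => r)).to_subtype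
  refine Finite.of_injective
    (fun J : MultiIndex n r =>
      (⟨J.1, fun i => (Finset.single_le_sum (f := J.1) (fun _ _ => Nat.zero_le _)
        (Finset.mem_univ i)).trans J.2⟩ : {J : Fin n → ℕ // J ∈ Set.Iic (fun _ : Fin n => r)})) ?_
  intro J K h
  exact Subtype.ext (congrArg (fun x => x.1) h)

instance multiIndexFintype (n r : ℕ) : Fintype (MultiIndex n r) := Fintype.ofFinite _

/-- Points `(x, u^{(r)})`: `n` independent variables, `m` dependent variables and all their
derivatives up to order `r`. -/
abbrev Jet (n m r : ℕ) : Type := (Fin n → ℝ) × (Fin m → MultiIndex n r → ℝ)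

/-- Forget the derivatives of order greater than `r`. -/
def Jet.trunc {n m r s : ℕ} (h : r ≤ s) (z : Jet n m s) : Jet n m r :=
  (z.1, fun α J => z.2 α ⟨J.1, J.2.trans h⟩)

/-- `op₁^{j₁} (op₂^{j₂} (⋯ (opₙ^{jₙ} b)))`. -/
def iterMulti {n : ℕ} {β : Type} (op : Fin n → β → β) (J : Fin n → ℕ) (b : β) : β :=
  (List.finRange n).foldr (fun i c => (op i)^[J i] c) b

/-- `∂g/∂xᵢ`. -/
def partialX {n : ℕ} (i : Fin n) (g : (Fin n → ℝ) → ℝ) : (Fin n → ℝ) → ℝ :=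
  fun x => deriv (fun t => g (Function.update x i t)) (x i)

/-- The `r`-jet at `x` of the map `u`. -/
def jetOf {n m : ℕ} (r : ℕ) (u : Fin m → (Fin n → ℝ) → ℝ) (x : Fin n → ℝ) : Jet n m r :=
  (x, fun α J => iterMulti partialX J.1 (u α) x)

/-- `f(x, u^{(r)}; ε)` is `C^∞` on a neighbourhood of `W × {ε = 0}`. -/
def SmoothNearZero {n m r : ℕ} (W : Set (Jet n m r)) (f : Jet n m r × ℝ → ℝ) : Prop :=
  ∃ O : Set (Jet n m r × ℝ), IsOpen O ∧ (∀ z ∈ W, (z, (0 : ℝ)) ∈ O) ∧ ContDiffOn ℝ ∞ f O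

/-- The jet variables `u_{(k)α,J}`, `k = 0,…,p`, `α = 1,…,m`, `J` any multi-index. -/
abbrev Coord (n m p : ℕ) : Type := Fin (p + 1) × Fin m × (Fin n → ℕ)

/-- Points `(x, (u_{(k)α,J}))`. Only functions that depend on finitely many of the coordinates
are considered on this space. -/
abbrev ExpJet (n m p : ℕ) : Type := (Fin n → ℝ) × (Coord n m p → ℝ)

/-- The jet at `x` of the coefficients `u_{(0)},…,u_{(p)}`. -/
def expJetOf {n m p : ℕ} (u : Fin (p + 1) → Fin m → (Fin n → ℝ) → ℝ) (x : Fin n → ℝ) :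
    ExpJet n m p :=
  (x, fun c => iterMulti partialX c.2.2 (u c.1 c.2.1) x)

/-- The point `(x, ∑ₖ εᵏ u_{(k)}^{(r)})`. -/
def perturbedJet {n m p : ℕ} (r : ℕ) (z : ExpJet n m p) (ε : ℝ) : Jet n m r :=
  (z.1, fun α J => ∑ k : Fin (p + 1), ε ^ (k : ℕ) * z.2 (k, α, J.1))

/-- The coefficient `f̃_{(k)}` of `εᵏ` in the expansion of `f(x, ∑ⱼ εʲ u_{(j)}^{(r)}; ε)` in powers
of `ε`. For `k ≤ p` it depends on `u_{(0)}^{(r)},…,u_{(k)}^{(r)}` only. -/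
def expCoeff {n m r : ℕ} (p : ℕ) (f : Jet n m r × ℝ → ℝ) (k : ℕ) : ExpJet n m p → ℝ :=
  fun z => iteratedDeriv k (fun ε : ℝ => f (perturbedJet r z ε, ε)) 0 / (k ! : ℝ)

/-- `∂F/∂u_{(k)α,J}`, for `c = (k, α, J)`. -/
def partialU {n m p : ℕ} (c : Coord n m p) (F : ExpJet n m p → ℝ) : ExpJet n m p → ℝ :=
  fun z => deriv (fun t => F (z.1, Function.update z.2 c t)) (z.2 c)

/-- The coordinate `u_{(k)α,Ji} = ∂ᵢ u_{(k)α,J}`. -/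
def Coord.shift {n m p : ℕ} (i : Fin n) (c : Coord n m p) : Coord n m p :=
  (c.1, c.2.1, c.2.2 + Pi.single i 1)

/-- The total derivative
`Dᵢ = ∂/∂xᵢ + ∑_{k=0}^p ∑_α ∑_J u_{(k)α,Ji} ∂/∂u_{(k)α,J}`; the sum is finite, since `F` depends on
finitely many coordinates. -/
def totalDeriv {n m p : ℕ} (i : Fin n) (F : ExpJet n m p → ℝ) : ExpJet n m p → ℝ :=
  fun z => deriv (fun t => F (Function.update z.1 i t, z.2)) (z.1 i)
    + ∑ᶠ c : Coord n m p, z.2 (c.shift i) * partialU c F z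

/-- The approximate Euler operator of order `r`,
`E_{u_{(0)α}} = ∑_{|J| ≤ r} (-1)^{|J|} D^J ∂/∂u_{(0)α,J}`. -/
def approxEuler {n m p : ℕ} (r : ℕ) (α : Fin m) (F : ExpJet n m p → ℝ) : ExpJet n m p → ℝ :=
  fun z => ∑ J : MultiIndex n r,
    (-1 : ℝ) ^ (∑ i, J.1 i) * iterMulti totalDeriv J.1 (partialU (0, α, J.1) F) z

/-- `∑_{ℓ=0}^k ∑_ν Λ̃^ν_{(ℓ)} Δ̃^ν_{(k-ℓ)}`. -/
def combCoeff {n m q r : ℕ} (p : ℕ) (Δ Λ : Fin q → Jet n m r × ℝ → ℝ) (k : ℕ) :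
    ExpJet n m p → ℝ :=
  fun z => ∑ l ∈ Finset.range (k + 1), ∑ ν : Fin q,
    expCoeff p (Λ ν) l z * expCoeff p (Δ ν) (k - l) z

/-- `∑ᵢ Dᵢ Φ̃^i_{(k)}`. -/
def divCoeff {n m s : ℕ} (p : ℕ) (Φ : Fin n → Jet n m s × ℝ → ℝ) (k : ℕ) : ExpJet n m p → ℝ :=
  fun z => ∑ i : Fin n, totalDeriv i (expCoeff p (Φ i) k) z

/-- `u_{(0)},…,u_{(p)}` are smooth on the open set `V`, and the `r`-jet of `u_{(0)}` has its values
in the domain `W`. -/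
structure Admissible {n m r : ℕ} (p : ℕ) (W : Set (Jet n m r)) (V : Set (Fin n → ℝ))
    (u : Fin (p + 1) → Fin m → (Fin n → ℝ) → ℝ) : Prop where
  isOpen : IsOpen V
  smooth : ∀ k α, ContDiffOn ℝ ∞ (u k α) V
  jet_mem : ∀ x ∈ V, jetOf r (u 0) x ∈ W

/-- Solutions on `V` of the approximate system `∑_{k=0}^p εᵏ Δ̃_{(k)} = O(ε^{p+1})`. -/
structure IsSolution {n m q r : ℕ} (p : ℕ) (D : Set (Jet n m r)) (Δ : Fin q → Jet n m r × ℝ → ℝ)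
    (V : Set (Fin n → ℝ)) (u : Fin (p + 1) → Fin m → (Fin n → ℝ) → ℝ) : Prop where
  admissible : Admissible p D V u
  eq_zero : ∀ ν, ∀ x ∈ V,
    (fun ε : ℝ => ∑ k ∈ Finset.range (p + 1), ε ^ k * expCoeff p (Δ ν) k (expJetOf u x))
      =O[𝓝 0] fun ε : ℝ => ε ^ (p + 1)

/-- Multipliers that are smooth on the domain `W` are non-singular when evaluated on the solutions
of the system with domain `D`: all jets of solutions lie in `W`. -/
def NonSingular {n m q r : ℕ} (p : ℕ) (D W : Set (Jet n m r))
    (Δ : Fin q → Jet n m r × ℝ → ℝ) : Prop :=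
  ∀ V u, IsSolution p D Δ V u → ∀ x ∈ V, jetOf r (u 0) x ∈ W

/-- The fluxes `Φ` give an approximate conservation law of the system:
`∑ₖ εᵏ ∑ᵢ Dᵢ Φ̃^i_{(k)} = O(ε^{p+1})` on all solutions. -/
def IsApproxConservationLaw {n m q r s : ℕ} (p : ℕ) (D : Set (Jet n m r))
    (Δ : Fin q → Jet n m r × ℝ → ℝ) (Φ : Fin n → Jet n m s × ℝ → ℝ) : Prop :=
  ∀ V u, IsSolution p D Δ V u → ∀ x ∈ V,
    (fun ε : ℝ => ∑ k ∈ Finset.range (p + 1), ε ^ k * divCoeff p Φ k (expJetOf u x))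
      =O[𝓝 0] fun ε : ℝ => ε ^ (p + 1)

/-- The multipliers `Λ`, with domain `W`, yield an approximate conservation law of the system `Δ`,
with domain `D`: there are fluxes of some finite order `s`, smooth for small `ε` wherever the
multipliers are, with
`∑ₖ εᵏ (∑_ℓ ∑_ν Λ̃^ν_{(ℓ)} Δ̃^ν_{(k-ℓ)} - ∑ᵢ Dᵢ Φ̃^i_{(k)}) = O(ε^{p+1})` for arbitrary `u_{(k)}(x)`,
and they give an approximate conservation law of the system. -/
def YieldsConservationLaw {n m q r : ℕ} (p : ℕ) (D W : Set (Jet n m r))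
    (Δ Λ : Fin q → Jet n m r × ℝ → ℝ) : Prop :=
  ∃ (s : ℕ) (h : r ≤ s) (Φ : Fin n → Jet n m s × ℝ → ℝ),
    (∀ i, SmoothNearZero (Jet.trunc h ⁻¹' W) (Φ i)) ∧
    (∀ V u, Admissible p W V u → ∀ x ∈ V,
      (fun ε : ℝ => ∑ k ∈ Finset.range (p + 1),
          ε ^ k * (combCoeff p Δ Λ k (expJetOf u x) - divCoeff p Φ k (expJetOf u x)))
        =O[𝓝 0] fun ε : ℝ => ε ^ (p + 1)) ∧
    IsApproxConservationLaw p D Δ Φ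

/-- The same, with fluxes that are defined near each given point of the domain of the
multipliers. -/
def LocallyYieldsConservationLaw {n m q r : ℕ} (p : ℕ) (W : Set (Jet n m r))
    (Δ Λ : Fin q → Jet n m r × ℝ → ℝ) : Prop :=
  ∀ z ∈ W, ∃ W' : Set (Jet n m r), IsOpen W' ∧ z ∈ W' ∧ W' ⊆ W ∧
    YieldsConservationLaw p W' W' Δ Λ

/-- `E_{u_{(0)α}} (∑ₖ εᵏ ∑_ℓ ∑_ν Λ̃^ν_{(ℓ)} Δ̃^ν_{(k-ℓ)}) = O(ε^{p+1})` for `α = 1,…,m` and arbitrary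
`u_{(k)}(x)`. -/
def EulerCondition {n m q r : ℕ} (p : ℕ) (W : Set (Jet n m r))
    (Δ Λ : Fin q → Jet n m r × ℝ → ℝ) : Prop :=
  ∀ α : Fin m, ∀ V u, Admissible p W V u → ∀ x ∈ V,
    (fun ε : ℝ => approxEuler r α
        (fun z => ∑ k ∈ Finset.range (p + 1), ε ^ k * combCoeff p Δ Λ k z) (expJetOf u x))
      =O[𝓝 0] fun ε : ℝ => ε ^ (p + 1)

/-- The domain `W` lies over a star-shaped set of `x`, and each of its fibres is star-shaped about
the jet of one smooth map `u⁰`. -/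
def StarShapedDomain {n m r : ℕ} (W : Set (Jet n m r)) : Prop :=
  ∃ (x₀ : Fin n → ℝ) (u₀ : Fin m → (Fin n → ℝ) → ℝ),
    StarConvex ℝ x₀ (Prod.fst '' W) ∧
    (∀ α, ContDiffOn ℝ ∞ (u₀ α) (Prod.fst '' W)) ∧
    ∀ z ∈ W, segment ℝ (jetOf r u₀ z.1) z ⊆ W

end ApproxCL

end

open ApproxCL

/-!
Put `L = ∑_ν Λ^ν Δ^ν`. By the Leibniz rule `∑_ℓ ∑_ν Λ̃^ν_{(ℓ)} Δ̃^ν_{(k-ℓ)} = L̃_{(k)}`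
(`combCoeff_eq_expCoeff`), and a polynomial of degree `p` in `ε` is `O(ε^{p+1})` only if it vanishes
(`isBigO_pow_iff`). Since every jet of finite order is the jet of polynomials (`exists_admissible`),
both conditions become identities between functions on the space of jets of the `u_{(k)}`, one for
each `k ≤ p`. The functions that occur depend smoothly on finitely many jet variables
(`IsJetFunOn`); for these `Dᵢ` is the derivative along the vector field `totalVec i`, whence
`[Dᵢ, Dⱼ] = 0` and `[∂_J, Dᵢ] = ∂_{J-eᵢ}`.

If fluxes exist, then `L̃_{(k)} = ∑ᵢ Dᵢ Φ̃^i_{(k)}`, and the Euler operator annihilates total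
derivatives (`approxEuler_totalDeriv`). The order of the fluxes may exceed `r`, but the terms of the
Euler operator beyond the order `r` do not contribute for `L̃_{(k)}` (`approxEuler_of_le`).

Conversely, let the Euler condition hold. At the jets with `u_{(1)} = ⋯ = u_{(p)} = 0` it says that
the ordinary Euler operators annihilate `L_k = (∂ᵏL/∂εᵏ)|_{ε=0} / k!`
(`approxEuler_comp_zeroExtend`). On a star-shaped domain such a function is a total divergence
(`isDivergenceOn_of_approxEuler_eq_zero`): with `w = u - u⁰` and the jets `uλ = u⁰ + λ w`,
`L_k(u) - L_k(u⁰) = ∑_{α,J} w_{α,J} ∫₀¹ (∂_{α,J} L_k)(uλ) dλ`,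
integration by parts turns the right-hand side into `∑_α w_α ∫₀¹ (E_α L_k)(uλ) dλ = 0` plus a
divergence, and `L_k(u⁰)` is a function of `x` alone on a star-shaped set, hence a divergence as
well (`exists_sum_partialX_eq`). If `L_k = ∑ᵢ Dᵢ P_kⁱ` for `k ≤ p`, then the fluxes
`Φⁱ = ∑ₖ εᵏ P_kⁱ` have `∑ᵢ Dᵢ Φ̃^i_{(k)} = L̃_{(k)}` for `k ≤ p`
(`divCoeff_powerFlux_eq_expCoeff`): total derivatives commute with the extraction of coefficients in
`ε`, and replacing `L(·; ε)` by its Taylor polynomial of degree `p` in `ε` does not change the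
coefficients of order at most `p` of `L` along a curve of jets (`iteratedDeriv_diag_taylor`). On
solutions `L̃_{(k)} = 0`, so that the fluxes give an approximate conservation law. For the local
statement a point has a neighbourhood that is star-shaped about the jets of a polynomial
(`exists_starShaped_nhds`).
-/

namespace ApproxCL

/-! ### Iterated operators indexed by multi-indices -/

section IterMulti

variable {n : ℕ} {X : Type}

/-- If `P` is preserved by all operators, then it is preserved by their multi-index powers. -/
lemma iterMulti_induction {β : Type} {op : Fin n → β → β} {P : β → Prop}
    (hP : ∀ i b, P b → P (op i b)) (J : Fin n → ℕ) {b : β} (hb : P b) : P (iterMulti op J b) := by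
  unfold iterMulti
  induction List.finRange n with
  | nil => exact hb
  | cons a l ih =>
    rw [List.foldr_cons]
    induction J a with
    | zero => exact ih
    | succ k hk => rw [Function.iterate_succ_apply']; exact hP _ _ hk

/-- If a map intertwines two families of operators, then it intertwines their powers. -/
lemma iterMulti_map {β γ : Type} {op : Fin n → β → β} {op' : Fin n → γ → γ} (e : β → γ)
    (h : ∀ i b, e (op i b) = op' i (e b)) (J : Fin n → ℕ) (b : β) :
    e (iterMulti op J b) = iterMulti op' J (e b) := by
  unfold iterMulti
  induction List.finRange n with
  | nil => rfl
  | cons a l ih =>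
    rw [List.foldr_cons, List.foldr_cons, ← ih]
    generalize List.foldr _ b l = c
    induction J a with
    | zero => rfl
    | succ k hk => rw [Function.iterate_succ_apply', Function.iterate_succ_apply', h, hk]

/-- Operators on functions, studied on the functions with the property `good` up to equality on the
set `S`, where they are local and commute. -/
structure CommutingOn (op : Fin n → (X → ℝ) → X → ℝ) (S : Set X) (good : (X → ℝ) → Prop) :
    Prop where
  good_op : ∀ i g, good g → good (op i g)
  congr : ∀ i g h, EqOn g h S → EqOn (op i g) (op i h) S
  comm : ∀ i j g, good g → EqOn (op i (op j g)) (op j (op i g)) S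

namespace CommutingOn

variable {op : Fin n → (X → ℝ) → X → ℝ} {S : Set X} {good : (X → ℝ) → Prop}

lemma good_iterate (h : CommutingOn op S good) (i : Fin n) (k : ℕ) {g : X → ℝ} (hg : good g) :
    good ((op i)^[k] g) := by
  induction k with
  | zero => exact hg
  | succ k ih => rw [Function.iterate_succ_apply']; exact h.good_op _ _ ih

lemma good_foldr (h : CommutingOn op S good) (J : Fin n → ℕ) (l : List (Fin n)) {g : X → ℝ}
    (hg : good g) : good (l.foldr (fun i c => (op i)^[J i] c) g) := by
  induction l with
  | nil => exact hg
  | cons a l ih => exact h.good_iterate _ _ ih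

lemma good_iterMulti (h : CommutingOn op S good) (J : Fin n → ℕ) {g : X → ℝ} (hg : good g) :
    good (iterMulti op J g) := h.good_foldr J _ hg

lemma congr_iterate (h : CommutingOn op S good) (i : Fin n) (k : ℕ) {g g' : X → ℝ}
    (hg : EqOn g g' S) : EqOn ((op i)^[k] g) ((op i)^[k] g') S := by
  induction k with
  | zero => exact hg
  | succ k ih =>
    rw [Function.iterate_succ_apply', Function.iterate_succ_apply']; exact h.congr _ _ _ ih

lemma congr_foldr (h : CommutingOn op S good) (J : Fin n → ℕ) (l : List (Fin n)) {g g' : X → ℝ}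
    (hg : EqOn g g' S) : EqOn (l.foldr (fun i c => (op i)^[J i] c) g)
      (l.foldr (fun i c => (op i)^[J i] c) g') S := by
  induction l with
  | nil => exact hg
  | cons a l ih => exact h.congr_iterate _ _ ih

lemma congr_iterMulti (h : CommutingOn op S good) (J : Fin n → ℕ) {g g' : X → ℝ}
    (hg : EqOn g g' S) : EqOn (iterMulti op J g) (iterMulti op J g') S := h.congr_foldr J _ hg

lemma iterate_op (h : CommutingOn op S good) (i j : Fin n) (k : ℕ) {g : X → ℝ} (hg : good g) :
    EqOn ((op j)^[k] (op i g)) (op i ((op j)^[k] g)) S := by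
  induction k with
  | zero => exact fun _ _ => rfl
  | succ k ih =>
    rw [Function.iterate_succ_apply', Function.iterate_succ_apply']
    exact (h.congr _ _ _ ih).trans (h.comm _ _ _ (h.good_iterate _ _ hg))

lemma foldr_op (h : CommutingOn op S good) (J : Fin n → ℕ) (i : Fin n) (l : List (Fin n))
    {g : X → ℝ} (hg : good g) :
    EqOn (l.foldr (fun i c => (op i)^[J i] c) (op i g))
      (op i (l.foldr (fun i c => (op i)^[J i] c) g)) S := by
  induction l with
  | nil => exact fun _ _ => rfl
  | cons a l ih =>
    exact (h.congr_iterate _ _ ih).trans (h.iterate_op _ _ _ (h.good_foldr _ _ hg))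

lemma iterMulti_op (h : CommutingOn op S good) (J : Fin n → ℕ) (i : Fin n) {g : X → ℝ}
    (hg : good g) : EqOn (iterMulti op J (op i g)) (op i (iterMulti op J g)) S :=
  h.foldr_op J i _ hg

lemma iterMulti_add_single (h : CommutingOn op S good) (J : Fin n → ℕ) (i : Fin n) {g : X → ℝ}
    (hg : good g) : EqOn (iterMulti op (J + Pi.single i 1) g) (op i (iterMulti op J g)) S := by
  have key : ∀ l : List (Fin n), l.Nodup →
      (i ∉ l → l.foldr (fun k c => (op k)^[(J + Pi.single i 1 : Fin n → ℕ) k] c) g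
        = l.foldr (fun k c => (op k)^[J k] c) g) ∧
      (i ∈ l → EqOn (l.foldr (fun k c => (op k)^[(J + Pi.single i 1 : Fin n → ℕ) k] c) g)
        (op i (l.foldr (fun k c => (op k)^[J k] c) g)) S) := by
    intro l hl
    induction l with
    | nil => simp
    | cons a l ih =>
      obtain ⟨hal, hl⟩ := List.nodup_cons.1 hl
      obtain ⟨ih1, ih2⟩ := ih hl
      constructor
      · intro hi
        simp only [List.mem_cons, not_or] at hi
        simp only [List.foldr_cons]
        rw [ih1 hi.2]
        simp [Ne.symm hi.1]
      · intro hi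
        simp only [List.foldr_cons]
        by_cases hia : i = a
        · subst hia
          rw [ih1 hal]
          simp only [Pi.add_apply, Pi.single_eq_same, Function.iterate_succ_apply']
          exact fun _ _ => rfl
        · have hil : i ∈ l := by simpa [hia] using hi
          have : (J + Pi.single i 1 : Fin n → ℕ) a = J a := by simp [Ne.symm hia]
          rw [this]
          exact (h.congr_iterate _ _ (ih2 hil)).trans (h.iterate_op _ _ _ (h.good_foldr _ _ hg))
  exact (key _ (List.nodup_finRange n)).2 (List.mem_finRange i)

/-- A transformation that commutes with the operators commutes with their powers. -/
lemma iterMulti_transform (h : CommutingOn op S good) (T : (X → ℝ) → X → ℝ)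
    (hop : ∀ i g, good g → EqOn (op i (T g)) (T (op i g)) S) (J : Fin n → ℕ) {g : X → ℝ}
    (hg : good g) : EqOn (iterMulti op J (T g)) (T (iterMulti op J g)) S := by
  unfold iterMulti
  induction List.finRange n with
  | nil => exact fun _ _ => rfl
  | cons a l ih =>
    simp only [List.foldr_cons]
    refine (h.congr_iterate _ _ ih).trans ?_
    generalize J a = N
    induction N with
    | zero => exact fun _ _ => rfl
    | succ N hN =>
      simp only [Function.iterate_succ_apply']
      exact (h.congr _ _ _ hN).trans (hop a _ (h.good_iterate _ _ (h.good_foldr _ _ hg)))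

end CommutingOn

/-- Additive operators have additive multi-index powers. -/
lemma iterMulti_sum {op : Fin n → (X → ℝ) → X → ℝ} {S : Set X} {good : (X → ℝ) → Prop}
    (h : CommutingOn op S good) {ι : Type} (s : Finset ι) (a : ι → ℝ) (g : ι → X → ℝ)
    (hg : ∀ k ∈ s, good (g k))
    (hlin : ∀ i (g : ι → X → ℝ), (∀ k ∈ s, good (g k)) →
      EqOn (op i (fun x => ∑ k ∈ s, a k * g k x)) (fun x => ∑ k ∈ s, a k * op i (g k) x) S)
    (J : Fin n → ℕ) :
    EqOn (iterMulti op J (fun x => ∑ k ∈ s, a k * g k x))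
      (fun x => ∑ k ∈ s, a k * iterMulti op J (g k) x) S := by
  unfold iterMulti
  induction List.finRange n with
  | nil => exact fun _ _ => rfl
  | cons b l ih =>
    simp only [List.foldr_cons]
    have hgl : ∀ k ∈ s, good (l.foldr (fun i c => (op i)^[J i] c) (g k)) :=
      fun k hk => h.good_foldr _ _ (hg k hk)
    refine (h.congr_iterate _ _ ih).trans ?_
    generalize J b = N
    induction N with
    | zero => exact fun _ _ => rfl
    | succ N hN =>
      simp only [Function.iterate_succ_apply']
      exact (h.congr _ _ _ hN).trans (hlin b _ fun k hk => h.good_iterate _ _ (hgl k hk))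

end IterMulti

/-- A sum over all indices may be restricted along an injective map whose range contains the
support. -/
lemma finsum_comp_of_injective {ι κ : Type} (e : ι → κ) (he : Function.Injective e) (h : κ → ℝ)
    (hs : ∀ c, c ∉ range e → h c = 0) : ∑ᶠ c, h c = ∑ᶠ a, h (e a) := by
  rw [← finsum_mem_univ h, ← finsum_mem_range (f := h) he]
  apply finsum_mem_inter_support_eq
  ext c
  simp only [mem_inter_iff, mem_univ, true_and, Function.mem_support]
  exact ⟨fun hc => ⟨by by_contra hn; exact hc (hs c hn), hc⟩, fun hc => hc.2⟩

/-! ### Functions of finitely many jet variables -/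

/-- The jet variables of order at most `N`. -/
abbrev FinCoord (n m p N : ℕ) : Type := Fin (p + 1) × Fin m × MultiIndex n N

/-- The finite-dimensional space of the `x` and the jet variables of order at most `N`. -/
abbrev FinJet (n m p N : ℕ) : Type := (Fin n → ℝ) × (FinCoord n m p N → ℝ)

/-- A jet variable of order at most `N`, as a jet variable. -/
def FinCoord.toCoord {n m p N : ℕ} (c : FinCoord n m p N) : Coord n m p := (c.1, c.2.1, c.2.2.1)

lemma FinCoord.toCoord_injective {n m p N : ℕ} :
    Function.Injective (FinCoord.toCoord : FinCoord n m p N → Coord n m p) := by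
  rintro ⟨k, α, J⟩ ⟨k', α', J'⟩ h
  simp only [toCoord, Prod.mk.injEq] at h
  obtain ⟨rfl, rfl, h⟩ := h
  rw [Subtype.ext h]

lemma FinCoord.mem_range_toCoord {n m p N : ℕ} {c : Coord n m p} :
    c ∈ range (FinCoord.toCoord : FinCoord n m p N → Coord n m p) ↔ ∑ i, c.2.2 i ≤ N := by
  constructor
  · rintro ⟨c, rfl⟩; exact c.2.2.2
  · intro h; exact ⟨(c.1, c.2.1, ⟨c.2.2, h⟩), rfl⟩

lemma sum_add_single {n : ℕ} (J : Fin n → ℕ) (i : Fin n) :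
    ∑ j, (J + Pi.single i 1 : Fin n → ℕ) j = ∑ j, J j + 1 := by
  simp [Finset.sum_add_distrib]

section

variable {n m p : ℕ}

/-- Forget the jet variables of order greater than `N`. -/
noncomputable def restr (N : ℕ) : ExpJet n m p →L[ℝ] FinJet n m p N where
  toFun z := (z.1, fun c => z.2 c.toCoord)
  map_add' _ _ := rfl
  map_smul' _ _ := rfl
  cont := by fun_prop

@[simp] lemma restr_fst (N : ℕ) (z : ExpJet n m p) : (restr N z).1 = z.1 := rfl

@[simp] lemma restr_snd (N : ℕ) (z : ExpJet n m p) (c : FinCoord n m p N) :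
    (restr N z).2 c = z.2 c.toCoord := rfl

/-- Raise the bound on the order of a jet variable. -/
def FinCoord.castLE {N N' : ℕ} (h : N ≤ N') (c : FinCoord n m p N) : FinCoord n m p N' :=
  (c.1, c.2.1, ⟨c.2.2.1, c.2.2.2.trans h⟩)

/-- Forget the jet variables of order greater than `N` in a jet of finite order. -/
noncomputable def finTrunc {N N' : ℕ} (h : N ≤ N') : FinJet n m p N' →L[ℝ] FinJet n m p N where
  toFun y := (y.1, fun c => y.2 (c.castLE h))
  map_add' _ _ := rfl
  map_smul' _ _ := rfl
  cont := by fun_prop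

@[simp] lemma finTrunc_restr {N N' : ℕ} (h : N ≤ N') (z : ExpJet n m p) :
    finTrunc h (restr N' z) = restr N z := rfl

/-- On the set `U`, the function `F` is a smooth function of `x` and the jet variables of order at
most `N`. -/
def IsJetFunOn (U : Set (ExpJet n m p)) (N : ℕ) (F : ExpJet n m p → ℝ) : Prop :=
  ∃ f : FinJet n m p N → ℝ, (∀ z ∈ U, ContDiffAt ℝ ∞ f (restr N z)) ∧ EqOn F (f ∘ restr N) U

variable {U : Set (ExpJet n m p)} {N : ℕ} {F G : ExpJet n m p → ℝ}

namespace IsJetFunOn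

lemma congr (hF : IsJetFunOn U N F) (h : EqOn G F U) : IsJetFunOn U N G := by
  obtain ⟨f, hf, hFf⟩ := hF
  exact ⟨f, hf, h.trans hFf⟩

lemma mono {N' : ℕ} (h : N ≤ N') (hF : IsJetFunOn U N F) : IsJetFunOn U N' F := by
  obtain ⟨f, hf, hFf⟩ := hF
  refine ⟨f ∘ finTrunc h, fun z hz => ?_, fun z hz => by rw [hFf hz]; rfl⟩
  exact ContDiffAt.comp _ (by simpa using hf z hz) (finTrunc h).contDiff.contDiffAt

lemma add (hF : IsJetFunOn U N F) (hG : IsJetFunOn U N G) :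
    IsJetFunOn U N (fun z => F z + G z) := by
  obtain ⟨f, hf, hFf⟩ := hF
  obtain ⟨g, hg, hGg⟩ := hG
  exact ⟨fun y => f y + g y, fun z hz => (hf z hz).add (hg z hz),
    fun z hz => by simp [hFf hz, hGg hz]⟩

lemma mul (hF : IsJetFunOn U N F) (hG : IsJetFunOn U N G) :
    IsJetFunOn U N (fun z => F z * G z) := by
  obtain ⟨f, hf, hFf⟩ := hF
  obtain ⟨g, hg, hGg⟩ := hG
  exact ⟨fun y => f y * g y, fun z hz => (hf z hz).mul (hg z hz),
    fun z hz => by simp [hFf hz, hGg hz]⟩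

lemma const (a : ℝ) : IsJetFunOn U N (fun _ => a) :=
  ⟨fun _ => a, fun _ _ => contDiffAt_const, fun _ _ => rfl⟩

lemma sum {ι : Type} {s : Finset ι} {F : ι → ExpJet n m p → ℝ}
    (h : ∀ k ∈ s, IsJetFunOn U N (F k)) : IsJetFunOn U N (fun z => ∑ k ∈ s, F k z) := by
  induction s using Finset.cons_induction with
  | empty => simpa using const 0
  | cons a s ha ih =>
    simp only [Finset.sum_cons]
    exact (h a (Finset.mem_cons_self _ _)).add
      (ih fun k hk => h k (Finset.mem_cons.2 (Or.inr hk)))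

/-- A smooth function of `x` alone. -/
lemma of_fst {g : (Fin n → ℝ) → ℝ} (hg : ∀ z ∈ U, ContDiffAt ℝ ∞ g z.1) :
    IsJetFunOn U N (fun z => g z.1) :=
  ⟨fun y => g y.1, fun z hz => ContDiffAt.comp _ (hg z hz) contDiffAt_fst, fun _ _ => rfl⟩

lemma coord {c : Coord n m p} (hc : ∑ i, c.2.2 i ≤ N) :
    IsJetFunOn U N (fun z => z.2 c) := by
  refine ⟨fun y => y.2 (c.1, c.2.1, ⟨c.2.2, hc⟩), fun z _ => ContDiff.contDiffAt ?_,
    fun _ _ => rfl⟩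
  fun_prop

end IsJetFunOn

/-! ### Derivatives of functions of finitely many jet variables -/

/-- The tangent vector of the curve of jets obtained by moving in the direction `xᵢ`. -/
def totalVec (i : Fin n) (z : ExpJet n m p) : ExpJet n m p :=
  (Pi.single i 1, fun c => z.2 (c.shift i))

/-- The tangent vector along the jet variable `c`. -/
def coordVec (c : Coord n m p) : ExpJet n m p := (0, Pi.single c 1)

lemma partialU_eq_lineDeriv (c : Coord n m p) (F : ExpJet n m p → ℝ) :
    partialU c F = fun z => lineDeriv ℝ F z (coordVec c) := by
  funext z
  have h : ∀ t : ℝ, z + t • coordVec c = (z.1, Function.update z.2 c (z.2 c + t)) := by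
    intro t
    ext j
    · simp [coordVec]
    · by_cases hj : j = c
      · subst hj; simp [coordVec]
      · simp [coordVec, hj]
  simp only [partialU, lineDeriv, h]
  rw [deriv_comp_const_add (f := fun t => F (z.1, Function.update z.2 c t))]
  simp

lemma partialX_part_eq_lineDeriv (i : Fin n) (F : ExpJet n m p → ℝ) (z : ExpJet n m p) :
    deriv (fun t => F (Function.update z.1 i t, z.2)) (z.1 i)
      = lineDeriv ℝ F z (Pi.single i 1, 0) := by
  have h : ∀ t : ℝ, z + t • ((Pi.single i 1, 0) : ExpJet n m p)
      = (Function.update z.1 i (z.1 i + t), z.2) := by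
    intro t
    ext j
    · by_cases hj : j = i
      · subst hj; simp
      · simp [hj]
    · simp
  simp only [lineDeriv, h]
  rw [deriv_comp_const_add (f := fun t => F (Function.update z.1 i t, z.2))]
  simp

lemma eventually_mem_line (hU : IsOpen U) {z : ExpJet n m p} (hz : z ∈ U) (ξ : ExpJet n m p) :
    ∀ᶠ t : ℝ in 𝓝 0, z + t • ξ ∈ U := by
  have : ContinuousAt (fun t : ℝ => z + t • ξ) 0 := by fun_prop
  exact this.eventually_mem (by simpa using hU.mem_nhds hz)

lemma lineDeriv_congr (hU : IsOpen U) (h : EqOn F G U) {z : ExpJet n m p} (hz : z ∈ U)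
    (ξ : ExpJet n m p) : lineDeriv ℝ F z ξ = lineDeriv ℝ G z ξ := by
  apply Filter.EventuallyEq.deriv_eq
  filter_upwards [eventually_mem_line hU hz ξ] with t ht using h ht

lemma partialU_congr (hU : IsOpen U) (h : EqOn F G U) (c : Coord n m p) :
    EqOn (partialU c F) (partialU c G) U := fun z hz => by
  simp only [partialU_eq_lineDeriv]
  exact lineDeriv_congr hU h hz _

lemma totalDeriv_congr (hU : IsOpen U) (h : EqOn F G U) (i : Fin n) :
    EqOn (totalDeriv i F) (totalDeriv i G) U := fun z hz => by
  simp only [totalDeriv, partialX_part_eq_lineDeriv]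
  rw [lineDeriv_congr hU h hz]
  congr 1
  exact finsum_congr fun c => by rw [partialU_congr hU h c hz]

lemma hasDerivAt_restr_line (N : ℕ) (z ξ : ExpJet n m p) (t : ℝ) :
    HasDerivAt (fun t : ℝ => restr N (z + t • ξ)) (restr N ξ) t := by
  simp only [map_add, map_smul]
  simpa using ((hasDerivAt_id t).smul_const (restr N ξ)).const_add (restr N z)

lemma hasLineDerivAt_of_eqOn {f : FinJet n m p N → ℝ} (hU : IsOpen U) {z : ExpJet n m p}
    (hz : z ∈ U) (hf : DifferentiableAt ℝ f (restr N z)) (hF : EqOn F (f ∘ restr N) U)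
    (ξ : ExpJet n m p) :
    HasLineDerivAt ℝ F (fderiv ℝ f (restr N z) (restr N ξ)) z ξ := by
  have h : HasDerivAt (fun t : ℝ => f (restr N (z + t • ξ)))
      (fderiv ℝ f (restr N z) (restr N ξ)) 0 := by
    have h0 : HasFDerivAt f (fderiv ℝ f (restr N z)) (restr N (z + (0 : ℝ) • ξ)) := by
      simpa using hf.hasFDerivAt
    exact h0.comp_hasDerivAt (0 : ℝ) (hasDerivAt_restr_line N z ξ 0)
  refine HasDerivAt.congr_of_eventuallyEq h ?_
  filter_upwards [eventually_mem_line hU hz ξ] with t ht using hF ht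

lemma lineDeriv_of_eqOn {f : FinJet n m p N → ℝ} (hU : IsOpen U) {z : ExpJet n m p}
    (hz : z ∈ U) (hf : DifferentiableAt ℝ f (restr N z)) (hF : EqOn F (f ∘ restr N) U)
    (ξ : ExpJet n m p) :
    lineDeriv ℝ F z ξ = fderiv ℝ f (restr N z) (restr N ξ) :=
  (hasLineDerivAt_of_eqOn hU hz hf hF ξ).lineDeriv

lemma IsJetFunOn.lineDifferentiableAt (hF : IsJetFunOn U N F) (hU : IsOpen U)
    {z : ExpJet n m p} (hz : z ∈ U) (ξ : ExpJet n m p) : LineDifferentiableAt ℝ F z ξ := by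
  obtain ⟨f, hf, hFf⟩ := hF
  exact (hasLineDerivAt_of_eqOn hU hz ((hf z hz).differentiableAt (by simp))
    hFf ξ).lineDifferentiableAt

lemma restr_coordVec_eq_zero {c : Coord n m p}
    (hc : c ∉ range (FinCoord.toCoord : FinCoord n m p N → Coord n m p)) :
    restr N (coordVec c) = 0 := by
  ext j
  · simp [coordVec]
  · have : j.toCoord ≠ c := fun h => hc ⟨j, h⟩
    simp [coordVec, this]

lemma restr_coordVec_toCoord (c : FinCoord n m p N) :
    restr N (coordVec c.toCoord) = (0, Pi.single c 1) := by
  ext j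
  · simp [coordVec]
  · by_cases h : j = c
    · subst h; simp [coordVec]
    · have : j.toCoord ≠ c.toCoord := fun h' => h (FinCoord.toCoord_injective h')
      simp [coordVec, this, h]

lemma partialU_eq_zero (hU : IsOpen U) (hF : IsJetFunOn U N F) {c : Coord n m p}
    (hc : N < ∑ i, c.2.2 i) : EqOn (partialU c F) 0 U := by
  intro z hz
  obtain ⟨f, hf, hFf⟩ := hF
  simp only [partialU_eq_lineDeriv]
  rw [lineDeriv_of_eqOn hU hz ((hf z hz).differentiableAt (by simp)) hFf,
    restr_coordVec_eq_zero (by rw [FinCoord.mem_range_toCoord]; omega)]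
  simp

/-- On functions of finitely many jet variables the total derivative is the derivative along
`totalVec`. -/
lemma totalDeriv_eq_lineDeriv (hU : IsOpen U) (hF : IsJetFunOn U N F) (i : Fin n)
    {z : ExpJet n m p} (hz : z ∈ U) : totalDeriv i F z = lineDeriv ℝ F z (totalVec i z) := by
  obtain ⟨f, hf, hFf⟩ := hF
  have hd := (hf z hz).differentiableAt (by simp)
  simp only [totalDeriv, partialX_part_eq_lineDeriv, partialU_eq_lineDeriv,
    lineDeriv_of_eqOn hU hz hd hFf]
  rw [finsum_comp_of_injective FinCoord.toCoord (FinCoord.toCoord_injective (N := N)),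
    finsum_eq_sum_of_fintype]
  · have : restr N (totalVec i z) = restr N ((Pi.single i 1, 0) : ExpJet n m p)
        + ∑ c : FinCoord n m p N, z.2 (c.toCoord.shift i) • restr N (coordVec c.toCoord) := by
      simp only [restr_coordVec_toCoord]
      ext j
      · simp [totalVec, Prod.fst_sum]
      · simp [totalVec, Prod.snd_sum, Finset.sum_apply, Pi.single_apply]
    rw [this, map_add, map_sum]
    simp
  · intro c hc
    rw [restr_coordVec_eq_zero hc]
    simp

lemma IsJetFunOn.lineDeriv_const (hF : IsJetFunOn U N F) (hU : IsOpen U) (ξ : ExpJet n m p) :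
    IsJetFunOn U N (fun z => lineDeriv ℝ F z ξ) := by
  obtain ⟨f, hf, hFf⟩ := hF
  refine ⟨fun y => fderiv ℝ f y (restr N ξ), fun z hz => ?_, fun z hz => ?_⟩
  · exact ((hf z hz).fderiv_right (m := ∞) (by simp)).clm_apply contDiffAt_const
  · exact lineDeriv_of_eqOn hU hz ((hf z hz).differentiableAt (by simp)) hFf ξ

lemma IsJetFunOn.partialU (hF : IsJetFunOn U N F) (hU : IsOpen U) (c : Coord n m p) :
    IsJetFunOn U N (partialU c F) := by
  rw [partialU_eq_lineDeriv]
  exact hF.lineDeriv_const hU _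

/-- `totalVec` on jets of finite order; it loses one order. -/
def finTotalVec (i : Fin n) (y : FinJet n m p (N + 1)) : FinJet n m p N :=
  (Pi.single i 1, fun c => y.2 (c.1, c.2.1, ⟨c.2.2.1 + Pi.single i 1, by
    rw [sum_add_single]; exact Nat.succ_le_succ c.2.2.2⟩))

lemma IsJetFunOn.totalDeriv (hF : IsJetFunOn U N F) (hU : IsOpen U) (i : Fin n) :
    IsJetFunOn U (N + 1) (totalDeriv i F) := by
  have hF' := hF
  obtain ⟨f, hf, hFf⟩ := hF
  refine ⟨fun y => fderiv ℝ f (finTrunc N.le_succ y) (finTotalVec i y), fun z hz => ?_,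
    fun z hz => ?_⟩
  · refine ContDiffAt.clm_apply ?_ ?_
    · exact ContDiffAt.comp _ (((hf z hz).fderiv_right (m := ∞) (by simp)))
        (finTrunc N.le_succ).contDiff.contDiffAt
    · apply ContDiff.contDiffAt
      unfold finTotalVec
      fun_prop
  · rw [totalDeriv_eq_lineDeriv hU hF' i hz,
      lineDeriv_of_eqOn hU hz ((hf z hz).differentiableAt (by simp)) hFf]
    rfl

/-- The derivative of `z ↦ (∂F)(η(z))` in the direction `ξ`, for a vector field `η` that is affine
along the line. -/
lemma lineDeriv_lineDeriv {f : FinJet n m p N → ℝ} (hU : IsOpen U)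
    (hf : ∀ z ∈ U, ContDiffAt ℝ ∞ f (restr N z)) (hF : EqOn F (f ∘ restr N) U)
    {z : ExpJet n m p} (hz : z ∈ U) (η : ExpJet n m p → ExpJet n m p) (ξ ζ : ExpJet n m p)
    (hη : ∀ t : ℝ, η (z + t • ξ) = η z + t • ζ) :
    lineDeriv ℝ (fun z => lineDeriv ℝ F z (η z)) z ξ
      = fderiv ℝ (fderiv ℝ f) (restr N z) (restr N ξ) (restr N (η z)) + lineDeriv ℝ F z ζ := by
  rw [lineDeriv_of_eqOn hU hz ((hf z hz).differentiableAt (by simp)) hF]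
  have h1 : HasDerivAt (fun t : ℝ => fderiv ℝ f (restr N (z + t • ξ)))
      (fderiv ℝ (fderiv ℝ f) (restr N z) (restr N ξ)) 0 := by
    have hd : DifferentiableAt ℝ (fderiv ℝ f) (restr N (z + (0 : ℝ) • ξ)) := by
      simpa using ((hf z hz).fderiv_right (m := ∞) (by simp)).differentiableAt (by simp)
    have := hd.hasFDerivAt.comp_hasDerivAt (0 : ℝ) (hasDerivAt_restr_line N z ξ 0)
    rw [zero_smul, add_zero] at this
    exact this
  have h2 := h1.clm_apply (hasDerivAt_restr_line N (η z) ζ 0)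
  have h3 : HasDerivAt (fun t : ℝ => lineDeriv ℝ F (z + t • ξ) (η (z + t • ξ)))
      (fderiv ℝ (fderiv ℝ f) (restr N z) (restr N ξ) (restr N (η z))
        + fderiv ℝ f (restr N z) (restr N ζ)) 0 := by
    simp only [zero_smul, add_zero] at h2
    refine h2.congr_of_eventuallyEq ?_
    filter_upwards [eventually_mem_line hU hz ξ] with t ht
    rw [lineDeriv_of_eqOn hU ht ((hf _ ht).differentiableAt (by simp)) hF, hη]
  exact h3.deriv

lemma fderiv_fderiv_symm {E : Type*} [NormedAddCommGroup E] [NormedSpace ℝ E] {f : E → ℝ} {y : E}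
    (hf : ContDiffAt ℝ ∞ f y) (a b : E) :
    fderiv ℝ (fderiv ℝ f) y a b = fderiv ℝ (fderiv ℝ f) y b a :=
  hf.isSymmSndFDerivAt (by
    rw [minSmoothness_of_isRCLikeNormedField]
    exact WithTop.coe_le_coe.2 (le_top : (2 : ℕ∞) ≤ ⊤)) a b

lemma totalVec_line (i : Fin n) (z ξ : ExpJet n m p) (t : ℝ) :
    totalVec i (z + t • ξ) = totalVec i z + t • ((0, fun c => ξ.2 (c.shift i)) : ExpJet n m p) := by
  ext j <;> simp [totalVec]

lemma shift_shift (i j : Fin n) (c : Coord n m p) : (c.shift i).shift j = (c.shift j).shift i := by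
  simp only [Coord.shift, add_assoc, add_comm (Pi.single i 1 : Fin n → ℕ)]

/-- Total derivatives commute. -/
lemma totalDeriv_comm (hU : IsOpen U) (hF : IsJetFunOn U N F) (i j : Fin n) :
    EqOn (totalDeriv i (totalDeriv j F)) (totalDeriv j (totalDeriv i F)) U := by
  have key : ∀ i j : Fin n, EqOn (totalDeriv i (totalDeriv j F))
      (fun z => lineDeriv ℝ (fun z => lineDeriv ℝ F z (totalVec j z)) z (totalVec i z)) U := by
    intro i j z hz
    rw [totalDeriv_eq_lineDeriv hU (hF.totalDeriv hU j) i hz]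
    exact lineDeriv_congr hU (fun z hz => totalDeriv_eq_lineDeriv hU hF j hz) hz _
  intro z hz
  rw [key i j hz, key j i hz]
  obtain ⟨f, hf, hFf⟩ := hF
  simp only
  rw [lineDeriv_lineDeriv hU hf hFf hz (totalVec j) (totalVec i z) _ (totalVec_line _ _ _),
    lineDeriv_lineDeriv hU hf hFf hz (totalVec i) (totalVec j z) _ (totalVec_line _ _ _),
    fderiv_fderiv_symm (hf z hz)]
  simp only [totalVec, shift_shift i j]

/-- `∂_c Dᵢ F = Dᵢ ∂_c F + ∂_{c-eᵢ} F`, in the case where `c - eᵢ` exists. -/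
lemma partialU_shift_totalDeriv (hU : IsOpen U) (hF : IsJetFunOn U N F) (i : Fin n)
    (c : Coord n m p) : EqOn (partialU (c.shift i) (totalDeriv i F))
      (fun z => totalDeriv i (partialU (c.shift i) F) z + partialU c F z) U := by
  intro z hz
  have hinj : Function.Injective (Coord.shift (n := n) (m := m) (p := p) i) := by
    rintro ⟨k, α, J⟩ ⟨k', α', J'⟩ h
    simpa [Coord.shift] using h
  have h1 : partialU (c.shift i) (totalDeriv i F) z
      = lineDeriv ℝ (fun z => lineDeriv ℝ F z (totalVec i z)) z (coordVec (c.shift i)) := by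
    rw [partialU_eq_lineDeriv]
    exact lineDeriv_congr hU (fun z hz => totalDeriv_eq_lineDeriv hU hF i hz) hz _
  simp only
  rw [h1, totalDeriv_eq_lineDeriv hU (hF.partialU hU _) i hz, partialU_eq_lineDeriv,
    partialU_eq_lineDeriv]
  obtain ⟨f, hf, hFf⟩ := hF
  rw [lineDeriv_lineDeriv hU hf hFf hz (totalVec i) (coordVec (c.shift i)) _ (totalVec_line _ _ _),
    lineDeriv_lineDeriv hU hf hFf hz (fun _ => coordVec (c.shift i)) (totalVec i z) 0 (by simp),
    fderiv_fderiv_symm (hf z hz)]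
  have h2 : ((0, fun c' => (coordVec (c.shift i)).2 (c'.shift i)) : ExpJet n m p) = coordVec c := by
    ext j
    · rfl
    · simp only [coordVec, Pi.single_apply, hinj.eq_iff]
  rw [h2]
  simp [lineDeriv_zero]

/-- `∂_c` and `Dᵢ` commute, if `c` does not contain a derivative with respect to `xᵢ`. -/
lemma partialU_totalDeriv_of_eq_zero (hU : IsOpen U) (hF : IsJetFunOn U N F) (i : Fin n)
    (c : Coord n m p) (hc : c.2.2 i = 0) : EqOn (partialU c (totalDeriv i F))
      (totalDeriv i (partialU c F)) U := by
  intro z hz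
  have h1 : partialU c (totalDeriv i F) z
      = lineDeriv ℝ (fun z => lineDeriv ℝ F z (totalVec i z)) z (coordVec c) := by
    rw [partialU_eq_lineDeriv]
    exact lineDeriv_congr hU (fun z hz => totalDeriv_eq_lineDeriv hU hF i hz) hz _
  rw [h1, totalDeriv_eq_lineDeriv hU (hF.partialU hU _) i hz, partialU_eq_lineDeriv]
  obtain ⟨f, hf, hFf⟩ := hF
  rw [lineDeriv_lineDeriv hU hf hFf hz (totalVec i) (coordVec c) _ (totalVec_line _ _ _),
    lineDeriv_lineDeriv hU hf hFf hz (fun _ => coordVec c) (totalVec i z) 0 (by simp),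
    fderiv_fderiv_symm (hf z hz)]
  have h2 : ((0, fun c' => (coordVec c).2 (c'.shift i)) : ExpJet n m p) = 0 := by
    ext j
    · rfl
    · have : j.shift i ≠ c := by
        rintro rfl
        simp [Coord.shift] at hc
      simp [coordVec, this]
  rw [h2]

lemma commutingOn_totalDeriv (hU : IsOpen U) :
    CommutingOn (totalDeriv (n := n) (m := m) (p := p)) U (fun F => ∃ N, IsJetFunOn U N F) where
  good_op := fun i _ ⟨_, h⟩ => ⟨_, h.totalDeriv hU i⟩
  congr := fun i _ _ h => totalDeriv_congr hU h i
  comm := fun i j _ ⟨_, h⟩ => totalDeriv_comm hU h i j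

lemma totalDeriv_sum (hU : IsOpen U) {ι : Type} (s : Finset ι) (a : ι → ℝ)
    (F : ι → ExpJet n m p → ℝ) (hF : ∀ k ∈ s, IsJetFunOn U N (F k)) (i : Fin n) :
    EqOn (totalDeriv i (fun z => ∑ k ∈ s, a k * F k z))
      (fun z => ∑ k ∈ s, a k * totalDeriv i (F k) z) U := by
  intro z hz
  rw [totalDeriv_eq_lineDeriv hU (.sum fun k hk => (IsJetFunOn.const (a k)).mul (hF k hk)) i hz]
  have h : ∀ k ∈ s, HasDerivAt (fun t : ℝ => a k * F k (z + t • totalVec i z))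
      (a k * totalDeriv i (F k) z) 0 := by
    intro k hk
    rw [totalDeriv_eq_lineDeriv hU (hF k hk) i hz]
    exact ((hF k hk).lineDifferentiableAt hU hz (totalVec i z)).hasLineDerivAt.const_mul (a k)
  exact (HasDerivAt.fun_sum h).deriv

lemma totalDeriv_mul (hU : IsOpen U) (hF : IsJetFunOn U N F) (hG : IsJetFunOn U N G) (i : Fin n) :
    EqOn (totalDeriv i (fun z => F z * G z))
      (fun z => totalDeriv i F z * G z + F z * totalDeriv i G z) U := by
  intro z hz
  simp only
  rw [totalDeriv_eq_lineDeriv hU (hF.mul hG) i hz, totalDeriv_eq_lineDeriv hU hF i hz,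
    totalDeriv_eq_lineDeriv hU hG i hz]
  have := (hF.lineDifferentiableAt hU hz (totalVec i z)).hasLineDerivAt.mul
    (hG.lineDifferentiableAt hU hz (totalVec i z)).hasLineDerivAt
  have h := this.deriv
  simp only [zero_smul, add_zero] at h
  exact h

lemma partialU_sum (hU : IsOpen U) {ι : Type} (s : Finset ι) (a : ι → ℝ)
    (F : ι → ExpJet n m p → ℝ) (hF : ∀ k ∈ s, IsJetFunOn U N (F k)) (c : Coord n m p) :
    EqOn (partialU c (fun z => ∑ k ∈ s, a k * F k z))
      (fun z => ∑ k ∈ s, a k * partialU c (F k) z) U := by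
  intro z hz
  simp only [partialU_eq_lineDeriv]
  have h : ∀ k ∈ s, HasDerivAt (fun t : ℝ => a k * F k (z + t • coordVec c))
      (a k * lineDeriv ℝ (F k) z (coordVec c)) 0 := fun k hk =>
    ((hF k hk).lineDifferentiableAt hU hz (coordVec c)).hasLineDerivAt.const_mul (a k)
  exact (HasDerivAt.fun_sum h).deriv

end

section

variable {n m p : ℕ} {U : Set (ExpJet n m p)} {N : ℕ} {F G : ExpJet n m p → ℝ}

/-! ### The Euler operator annihilates total divergences -/

lemma exists_common_order {ι : Type} {s : Finset ι} {F : ι → ExpJet n m p → ℝ}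
    (h : ∀ k ∈ s, ∃ N, IsJetFunOn U N (F k)) : ∃ N, ∀ k ∈ s, IsJetFunOn U N (F k) := by
  induction s using Finset.cons_induction with
  | empty => exact ⟨0, by simp⟩
  | cons a s ha ih =>
    obtain ⟨N, hN⟩ := ih fun k hk => h k (Finset.mem_cons.2 (Or.inr hk))
    obtain ⟨N', hN'⟩ := h a (Finset.mem_cons_self _ _)
    refine ⟨max N N', fun k hk => ?_⟩
    rcases Finset.mem_cons.1 hk with rfl | hk
    · exact hN'.mono (le_max_right _ _)
    · exact (hN k hk).mono (le_max_left _ _)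

lemma totalDeriv_zero (i : Fin n) : totalDeriv (m := m) (p := p) i (fun _ => 0) = fun _ => 0 := by
  funext z
  simp [totalDeriv, partialU]

lemma iterMulti_totalDeriv_eq_zero (hU : IsOpen U) (h : EqOn F (fun _ => 0) U) (J : Fin n → ℕ) :
    EqOn (iterMulti totalDeriv J F) (fun _ => 0) U := by
  refine ((commutingOn_totalDeriv hU).congr_iterMulti J h).trans ?_
  rw [iterMulti_induction (op := totalDeriv (n := n) (m := m) (p := p))
    (P := fun F => F = fun _ => 0) (fun i b hb => by rw [hb]; exact totalDeriv_zero i) J rfl]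
  exact fun _ _ => rfl

lemma iterMulti_totalDeriv_sum (hU : IsOpen U) {ι : Type} (s : Finset ι) (a : ι → ℝ)
    (F : ι → ExpJet n m p → ℝ) (hF : ∀ k ∈ s, ∃ N, IsJetFunOn U N (F k)) (J : Fin n → ℕ) :
    EqOn (iterMulti totalDeriv J (fun z => ∑ k ∈ s, a k * F k z))
      (fun z => ∑ k ∈ s, a k * iterMulti totalDeriv J (F k) z) U := by
  refine iterMulti_sum (commutingOn_totalDeriv hU) s a F hF (fun i G hG => ?_) J
  obtain ⟨N, hN⟩ := exists_common_order hG
  exact totalDeriv_sum hU s a G hN i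

lemma approxEuler_congr (hU : IsOpen U) (h : EqOn F G U) (r : ℕ) (α : Fin m) :
    EqOn (approxEuler r α F) (approxEuler r α G) U := fun z hz => by
  simp only [approxEuler]
  refine Finset.sum_congr rfl fun J _ => ?_
  rw [(commutingOn_totalDeriv hU).congr_iterMulti J.1 (partialU_congr hU h _) hz]

lemma exists_isJetFunOn_approxEuler (hU : IsOpen U) (hF : IsJetFunOn U N F) (r : ℕ) (α : Fin m) :
    ∃ N', IsJetFunOn U N' (approxEuler r α F) := by
  have h : ∀ J ∈ (Finset.univ : Finset (MultiIndex n r)), ∃ N', IsJetFunOn U N'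
      (fun z => (-1 : ℝ) ^ (∑ i, J.1 i) * iterMulti totalDeriv J.1 (partialU (0, α, J.1) F) z) := by
    intro J _
    obtain ⟨N', h⟩ := (commutingOn_totalDeriv hU).good_iterMulti J.1 ⟨N, hF.partialU hU (0, α, J.1)⟩
    exact ⟨N', (IsJetFunOn.const _).mul h⟩
  obtain ⟨N', h⟩ := exists_common_order h
  exact ⟨N', .sum h⟩

lemma approxEuler_sum (hU : IsOpen U) {ι : Type} (s : Finset ι) (a : ι → ℝ)
    (F : ι → ExpJet n m p → ℝ) (hF : ∀ k ∈ s, IsJetFunOn U N (F k)) (r : ℕ) (α : Fin m) :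
    EqOn (approxEuler r α (fun z => ∑ k ∈ s, a k * F k z))
      (fun z => ∑ k ∈ s, a k * approxEuler r α (F k) z) U := by
  intro z hz
  simp only [approxEuler, Finset.mul_sum]
  rw [Finset.sum_comm]
  refine Finset.sum_congr rfl fun J _ => ?_
  rw [(commutingOn_totalDeriv hU).congr_iterMulti J.1 (partialU_sum hU s a F hF _) hz,
    iterMulti_totalDeriv_sum hU s a _ (fun k hk => ⟨N, (hF k hk).partialU hU _⟩) J.1 hz,
    Finset.mul_sum]
  exact Finset.sum_congr rfl fun k _ => by ring

lemma sub_single_add_single (J : Fin n → ℕ) (i : Fin n) (hJ : J i ≠ 0) :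
    J - Pi.single i 1 + Pi.single i 1 = J := by
  funext j
  by_cases h : j = i
  · subst h
    simp only [Pi.add_apply, Pi.sub_apply, Pi.single_eq_same]
    omega
  · simp [h]

/-- The multi-indices of order at most `r`, as a finite set. -/
noncomputable def multiIndices (n r : ℕ) : Finset (Fin n → ℕ) :=
  (Finset.univ : Finset (MultiIndex n r)).map (Function.Embedding.subtype _)

@[simp] lemma mem_multiIndices {n r : ℕ} {J : Fin n → ℕ} :
    J ∈ multiIndices n r ↔ ∑ i, J i ≤ r := by
  simp [multiIndices]

lemma sum_multiIndex {r : ℕ} (h : (Fin n → ℕ) → ℝ) :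
    ∑ J : MultiIndex n r, h J.1 = ∑ J ∈ multiIndices n r, h J := by
  simp [multiIndices]

lemma approxEuler_eq_sum (r : ℕ) (α : Fin m) (F : ExpJet n m p → ℝ) (z : ExpJet n m p) :
    approxEuler r α F z = ∑ J ∈ multiIndices n r,
      (-1 : ℝ) ^ (∑ i, J i) * iterMulti totalDeriv J (partialU (0, α, J) F) z :=
  sum_multiIndex fun J => (-1 : ℝ) ^ (∑ i, J i) * iterMulti totalDeriv J (partialU (0, α, J) F) z

/-- The terms of the Euler operator beyond the order of the function vanish. -/
lemma approxEuler_of_le (hU : IsOpen U) {r s : ℕ} (hrs : r ≤ s) (hF : IsJetFunOn U r F)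
    (α : Fin m) : EqOn (approxEuler s α F) (approxEuler r α F) U := by
  intro z hz
  rw [approxEuler_eq_sum, approxEuler_eq_sum]
  symm
  refine Finset.sum_subset (fun J hJ => ?_) fun J _ hJ => ?_
  · rw [mem_multiIndices] at *; omega
  · rw [mem_multiIndices, not_le] at hJ
    rw [iterMulti_totalDeriv_eq_zero hU (partialU_eq_zero hU hF hJ) J hz, mul_zero]

/-- The Euler operator annihilates total derivatives: the two terms of
`∂_J Dᵢ = Dᵢ ∂_J + ∂_{J-eᵢ}` cancel after summation by parts. -/
lemma approxEuler_totalDeriv (hU : IsOpen U) (hF : IsJetFunOn U N F) (i : Fin n) (α : Fin m) :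
    EqOn (approxEuler (N + 1) α (totalDeriv i F)) (fun _ => 0) U := by
  intro z hz
  have hC := commutingOn_totalDeriv hU
  -- the contribution of `Dᵢ ∂_J F`; that of `∂_{J-eᵢ} F` is `-A (J - eᵢ)`
  set A : (Fin n → ℕ) → ℝ := fun J =>
    (-1 : ℝ) ^ (∑ i, J i) * iterMulti totalDeriv (J + Pi.single i 1) (partialU (0, α, J) F) z
    with hA
  have hA0 : ∀ J : Fin n → ℕ, N < ∑ i, J i → A J = 0 := fun J hJ => by
    simp only [hA]
    rw [iterMulti_totalDeriv_eq_zero hU (partialU_eq_zero hU hF hJ) _ hz, mul_zero]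
  have hAD : ∀ J, A J = (-1 : ℝ) ^ (∑ i, J i)
      * iterMulti totalDeriv J (totalDeriv i (partialU (0, α, J) F)) z := fun J => by
    simp only [hA]
    rw [hC.iterMulti_add_single J i ⟨N, hF.partialU hU _⟩ hz,
      hC.iterMulti_op J i ⟨N, hF.partialU hU _⟩ hz]
  have hterm : ∀ J : Fin n → ℕ,
      (-1 : ℝ) ^ (∑ i, J i) * iterMulti totalDeriv J (partialU (0, α, J) (totalDeriv i F)) z
        = A J - if J i = 0 then 0 else A (J - Pi.single i 1) := by
    intro J
    by_cases hJ : J i = 0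
    · rw [if_pos hJ, sub_zero, hAD,
        hC.congr_iterMulti J (partialU_totalDeriv_of_eq_zero hU hF i (0, α, J) hJ) hz]
    · rw [if_neg hJ]
      obtain ⟨K, hK⟩ : ∃ K, J - Pi.single i 1 = K := ⟨_, rfl⟩
      have hJK : J = K + Pi.single i 1 := by rw [← hK, sub_single_add_single J i hJ]
      rw [hK, hAD]
      subst hJK
      have h1 := hC.congr_iterMulti (K + Pi.single i 1)
        (partialU_shift_totalDeriv hU hF i (0, α, K)) hz
      have h2 := iterMulti_totalDeriv_sum hU Finset.univ (fun _ : Fin 2 => (1 : ℝ))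
        ![totalDeriv i (partialU (Coord.shift i (0, α, K)) F), partialU (0, α, K) F] (by
          intro k _
          fin_cases k
          · exact ⟨N + 1, (hF.partialU hU _).totalDeriv hU i⟩
          · exact ⟨N, hF.partialU hU _⟩) (K + Pi.single i 1) hz
      simp only [Fin.sum_univ_two, one_mul, Matrix.cons_val_zero, Matrix.cons_val_one] at h2
      have h3 : iterMulti totalDeriv (K + Pi.single i 1)
          (partialU (0, α, K + Pi.single i 1) (totalDeriv i F)) z
          = iterMulti totalDeriv (K + Pi.single i 1)
            (totalDeriv i (partialU (0, α, K + Pi.single i 1) F)) z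
          + iterMulti totalDeriv (K + Pi.single i 1) (partialU (0, α, K) F) z := h1.trans h2
      rw [h3]
      simp only [hA, sum_add_single, pow_succ]
      ring
  rw [approxEuler_eq_sum, Finset.sum_congr rfl fun J _ => hterm J, Finset.sum_sub_distrib,
    sub_eq_zero]
  have h1 : ∑ J ∈ multiIndices n (N + 1), A J = ∑ J ∈ multiIndices n N, A J := by
    symm
    refine Finset.sum_subset (fun J hJ => ?_) fun J _ hJ => ?_
    · rw [mem_multiIndices] at *; omega
    · rw [mem_multiIndices, not_le] at hJ
      exact hA0 J hJ
  rw [h1]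
  refine Finset.sum_of_injOn (fun J => J + Pi.single i 1) (fun J _ K _ h => add_right_cancel h)
    (fun J hJ => ?_) (fun J hJ hJ' => ?_) fun J hJ => ?_
  · simp only [Finset.mem_coe, mem_multiIndices, sum_add_single] at *; omega
  · by_cases hJi : J i = 0
    · simp [hJi]
    · refine absurd ⟨J - Pi.single i 1, ?_, sub_single_add_single J i hJi⟩ hJ'
      have := sum_add_single (J - Pi.single i 1) i
      rw [sub_single_add_single J i hJi] at this
      simp only [Finset.mem_coe, mem_multiIndices] at *
      omega
  · simp

/-! ### Total divergences and integration by parts -/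

/-- On `U`, the function `H` is a total divergence of functions of finitely many jet variables. -/
def IsDivergenceOn (U : Set (ExpJet n m p)) (H : ExpJet n m p → ℝ) : Prop :=
  ∃ (N : ℕ) (Φ : Fin n → ExpJet n m p → ℝ), (∀ i, IsJetFunOn U N (Φ i)) ∧
    EqOn H (fun z => ∑ i, totalDeriv i (Φ i) z) U

namespace IsDivergenceOn

variable {H H' : ExpJet n m p → ℝ}

lemma congr (hH : IsDivergenceOn U H) (h : EqOn H' H U) : IsDivergenceOn U H' := by
  obtain ⟨N, Φ, hΦ, hH⟩ := hH
  exact ⟨N, Φ, hΦ, h.trans hH⟩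

lemma sum {ι : Type} (hU : IsOpen U) (s : Finset ι) (a : ι → ℝ) (H : ι → ExpJet n m p → ℝ)
    (h : ∀ k ∈ s, IsDivergenceOn U (H k)) :
    IsDivergenceOn U (fun z => ∑ k ∈ s, a k * H k z) := by
  classical
  choose! N Φ hΦ hH using h
  have hN : ∀ k ∈ s, ∀ i, IsJetFunOn U (s.sup N) (Φ k i) := fun k hk i =>
    (hΦ k hk i).mono (Finset.le_sup hk)
  refine ⟨s.sup N, fun i z => ∑ k ∈ s, a k * Φ k i z, fun i => .sum fun k hk =>
    (IsJetFunOn.const _).mul (hN k hk i), fun z hz => ?_⟩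
  simp only
  rw [Finset.sum_congr rfl fun i _ => totalDeriv_sum hU s a (fun k => Φ k i)
    (fun k hk => hN k hk i) i hz, Finset.sum_comm]
  exact Finset.sum_congr rfl fun k hk => by rw [hH k hk hz, Finset.mul_sum]

lemma totalDeriv (hF : IsJetFunOn U N F) (i : Fin n) : IsDivergenceOn U (totalDeriv i F) := by
  refine ⟨N, fun j => if j = i then F else fun _ => 0, fun j => ?_, fun z _ => ?_⟩
  · by_cases h : j = i
    · simpa [h] using hF
    · simp [h, IsJetFunOn.const]
  · simp only
    rw [Finset.sum_eq_single i]
    · simp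
    · intro j _ hj
      rw [if_neg hj, totalDeriv_zero]
    · simp

lemma zero : IsDivergenceOn U (fun _ => 0) :=
  ⟨0, fun _ _ => 0, fun _ => .const 0, fun z _ => by simp [totalDeriv_zero]⟩

lemma add (hU : IsOpen U) (h : IsDivergenceOn U H) (h' : IsDivergenceOn U H') :
    IsDivergenceOn U (fun z => H z + H' z) := by
  have := sum hU Finset.univ (fun _ : Fin 2 => (1 : ℝ)) ![H, H'] (by
    intro k _
    fin_cases k
    · exact h
    · exact h')
  simpa [Fin.sum_univ_two] using this

lemma sub (hU : IsOpen U) (h : IsDivergenceOn U H) (h' : IsDivergenceOn U H') :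
    IsDivergenceOn U (fun z => H z - H' z) := by
  have := sum hU Finset.univ (![1, -1] : Fin 2 → ℝ) ![H, H'] (by
    intro k _
    fin_cases k
    · exact h
    · exact h')
  simpa [Fin.sum_univ_two, ← sub_eq_add_neg] using this

end IsDivergenceOn

lemma iterMulti_zero {β : Type} (op : Fin n → β → β) (b : β) : iterMulti op 0 b = b := by
  unfold iterMulti
  induction List.finRange n with
  | nil => rfl
  | cons a l ih => simp

/-- Integration by parts: `(Dᴶ w) G` and `(-1)^{|J|} w Dᴶ G` differ by a total divergence. -/
lemma isDivergenceOn_by_parts (hU : IsOpen U) (w : (Fin n → ℕ) → ExpJet n m p → ℝ)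
    (hw : ∀ J, ∃ N, IsJetFunOn U N (w J))
    (hD : ∀ i J, EqOn (totalDeriv i (w J)) (w (J + Pi.single i 1)) U) (J : Fin n → ℕ)
    (hG : ∃ N, IsJetFunOn U N G) :
    IsDivergenceOn U (fun z => w J z * G z
      - (-1 : ℝ) ^ (∑ i, J i) * (w 0 z * iterMulti totalDeriv J G z)) := by
  have hC := commutingOn_totalDeriv hU
  obtain ⟨d, hd⟩ : ∃ d, ∑ i, J i = d := ⟨_, rfl⟩
  induction d generalizing J G with
  | zero =>
    have hJ : J = 0 := by
      ext i
      exact (Finset.sum_eq_zero_iff.1 hd) i (Finset.mem_univ i)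
    subst hJ
    refine IsDivergenceOn.zero.congr fun z _ => ?_
    simp [iterMulti_zero]
  | succ d ih =>
    obtain ⟨i, hi⟩ : ∃ i, J i ≠ 0 := by
      by_contra! h
      simp [h] at hd
    obtain ⟨K, rfl⟩ : ∃ K : Fin n → ℕ, J = K + Pi.single i 1 :=
      ⟨_, (sub_single_add_single J i hi).symm⟩
    rw [sum_add_single] at hd
    obtain ⟨N, hG⟩ := hG
    obtain ⟨N', hK⟩ := hw K
    have hG' := hG.mono (le_max_left N N')
    have hK' := hK.mono (le_max_right N N')
    have h1 := IsDivergenceOn.totalDeriv (hK'.mul hG') i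
    have h2 := ih K ⟨_, hG.totalDeriv hU i⟩ (by omega)
    refine (h1.sub hU h2).congr fun z hz => ?_
    simp only
    rw [totalDeriv_mul hU hK' hG' i hz]
    simp only
    rw [hD i K hz, hC.iterMulti_add_single K i ⟨N, hG⟩ hz,
      hC.iterMulti_op K i ⟨N, hG⟩ hz, sum_add_single, pow_succ]
    ring

end

section

variable {n m p r : ℕ}

/-! ### Jets of smooth maps -/

lemma partialX_eq_fderiv (i : Fin n) {g : (Fin n → ℝ) → ℝ} {x : Fin n → ℝ}
    (hg : DifferentiableAt ℝ g x) : partialX i g x = fderiv ℝ g x (Pi.single i 1) := by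
  have h : HasDerivAt (fun t => g (Function.update x i t)) (fderiv ℝ g x (Pi.single i 1)) (x i) := by
    have h0 : HasFDerivAt g (fderiv ℝ g x) (Function.update x i (x i)) := by
      simpa using hg.hasFDerivAt
    exact h0.comp_hasDerivAt (x i) (hasDerivAt_update x i (x i))
  exact h.deriv

lemma partialX_congr {V : Set (Fin n → ℝ)} (hV : IsOpen V) {g h : (Fin n → ℝ) → ℝ}
    (hgh : EqOn g h V) (i : Fin n) : EqOn (partialX i g) (partialX i h) V := by
  intro x hx
  apply Filter.EventuallyEq.deriv_eq
  have hc : ContinuousAt (fun t => Function.update x i t) (x i) := by fun_prop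
  filter_upwards [hc.eventually_mem (by simpa using hV.mem_nhds hx)] with t ht using hgh ht

lemma commutingOn_partialX {V : Set (Fin n → ℝ)} (hV : IsOpen V) :
    CommutingOn (partialX (n := n)) V (fun g => ContDiffOn ℝ ∞ g V) := by
  have hd : ∀ g, ContDiffOn ℝ ∞ g V → ∀ i,
      EqOn (partialX i g) (fun x => fderiv ℝ g x (Pi.single i 1)) V := fun g hg i x hx =>
    partialX_eq_fderiv i ((hg.contDiffAt (hV.mem_nhds hx)).differentiableAt (by simp))
  refine ⟨fun i g hg => ?_, fun i g h hgh => partialX_congr hV hgh i, fun i j g hg x hx => ?_⟩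
  · exact ((hg.fderiv_of_isOpen (m := ∞) hV (by simp)).clm_apply contDiffOn_const).congr (hd g hg i)
  · have key : ∀ i j : Fin n, partialX i (partialX j g) x
        = fderiv ℝ (fderiv ℝ g) x (Pi.single i 1) (Pi.single j 1) := by
      intro i j
      have hf := hg.contDiffAt (hV.mem_nhds hx)
      have hd2 : DifferentiableAt ℝ (fderiv ℝ g) x :=
        (hf.fderiv_right (m := ∞) (by simp)).differentiableAt (by simp)
      rw [partialX_congr hV (hd g hg j) i hx, partialX_eq_fderiv i
        (hd2.clm_apply (differentiableAt_const _)), fderiv_clm_apply hd2 (differentiableAt_const _)]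
      simp
    rw [key, key]
    exact fderiv_fderiv_symm (hg.contDiffAt (hV.mem_nhds hx)) _ _

lemma contDiffOn_iterMulti {V : Set (Fin n → ℝ)} (hV : IsOpen V) {g : (Fin n → ℝ) → ℝ}
    (hg : ContDiffOn ℝ ∞ g V) (J : Fin n → ℕ) : ContDiffOn ℝ ∞ (iterMulti partialX J g) V :=
  (commutingOn_partialX hV).good_iterMulti J hg

lemma iterMulti_partialX_sum {V : Set (Fin n → ℝ)} (hV : IsOpen V) {ι : Type} (s : Finset ι)
    (a : ι → ℝ) (g : ι → (Fin n → ℝ) → ℝ) (hg : ∀ k ∈ s, ContDiffOn ℝ ∞ (g k) V) (J : Fin n → ℕ) :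
    EqOn (iterMulti partialX J (fun x => ∑ k ∈ s, a k * g k x))
      (fun x => ∑ k ∈ s, a k * iterMulti partialX J (g k) x) V := by
  refine iterMulti_sum (commutingOn_partialX hV) s a g hg (fun i g hg x hx => ?_) J
  have hd : ∀ k ∈ s, DifferentiableAt ℝ (g k) x := fun k hk =>
    ((hg k hk).contDiffAt (hV.mem_nhds hx)).differentiableAt (by simp)
  rw [partialX_eq_fderiv i (DifferentiableAt.fun_sum fun k hk => (hd k hk).const_mul (a k)),
    fderiv_fun_sum fun k hk => (hd k hk).const_mul (a k)]
  simp only [sum_apply]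
  refine Finset.sum_congr rfl fun k hk => ?_
  rw [fderiv_const_mul (hd k hk), partialX_eq_fderiv i (hd k hk)]
  rfl

lemma continuousOn_jetOf {V : Set (Fin n → ℝ)} (hV : IsOpen V) {u : Fin m → (Fin n → ℝ) → ℝ}
    (hu : ∀ α, ContDiffOn ℝ ∞ (u α) V) (r : ℕ) : ContinuousOn (jetOf r u) V := by
  unfold jetOf
  refine continuousOn_id.prodMk (continuousOn_pi.2 fun α => continuousOn_pi.2 fun J => ?_)
  exact (contDiffOn_iterMulti hV (hu α) J.1).continuousOn

/-! ### Every jet of finite order is the jet of a polynomial -/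

lemma partialX_prod (i : Fin n) (e : Fin n → ℝ → ℝ) :
    partialX i (fun x => ∏ j, e j (x j))
      = fun x => ∏ j, Function.update e i (deriv (e i)) j (x j) := by
  funext x
  have h : ∀ t, ∏ j, e j (Function.update x i t j)
      = e i t * ∏ j ∈ Finset.univ.erase i, e j (x j) := by
    intro t
    rw [← Finset.mul_prod_erase _ _ (Finset.mem_univ i), Function.update_self]
    congr 1
    exact Finset.prod_congr rfl fun j hj => by
      rw [Function.update_of_ne (Finset.ne_of_mem_erase hj)]
  simp only [partialX, h]
  rw [deriv_mul_const_field, ← Finset.mul_prod_erase _ _ (Finset.mem_univ i), Function.update_self]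
  congr 1
  exact Finset.prod_congr rfl fun j hj => by
    rw [Function.update_of_ne (Finset.ne_of_mem_erase hj)]

lemma iterMulti_partialX_prod (J : Fin n → ℕ) (e : Fin n → ℝ → ℝ) :
    iterMulti partialX J (fun x => ∏ j, e j (x j))
      = fun x => ∏ j, (deriv^[J j] (e j)) (x j) := by
  have hit : ∀ (i : Fin n) (k : ℕ) (e : Fin n → ℝ → ℝ),
      (partialX i)^[k] (fun x => ∏ j, e j (x j))
        = fun x => ∏ j, Function.update e i (deriv^[k] (e i)) j (x j) := by
    intro i k e
    induction k with
    | zero => simp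
    | succ k ih =>
      rw [Function.iterate_succ_apply', ih, partialX_prod]
      simp [Function.iterate_succ_apply']
  have key : ∀ l : List (Fin n), l.Nodup →
      l.foldr (fun i c => (partialX i)^[J i] c) (fun x => ∏ j, e j (x j))
        = fun x => ∏ j, (if j ∈ l then deriv^[J j] (e j) else e j) (x j) := by
    intro l hl
    induction l with
    | nil => simp
    | cons a l ih =>
      obtain ⟨hal, hl⟩ := List.nodup_cons.1 hl
      rw [List.foldr_cons, ih hl, hit]
      funext x
      refine Finset.prod_congr rfl fun j _ => ?_
      by_cases h : j = a
      · subst h; simp [hal]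
      · simp [h]
  unfold iterMulti
  rw [key _ (List.nodup_finRange n)]
  simp

/-- `(t - a)ᵏ / k!`, the functions dual to the derivatives at `a`. -/
noncomputable def taylorMonomial (a : ℝ) (k : ℕ) (t : ℝ) : ℝ := (t - a) ^ k / (k ! : ℝ)

lemma deriv_iterate_taylorMonomial (a : ℝ) (k j : ℕ) :
    (deriv^[j] (taylorMonomial a k)) a = if j = k then 1 else 0 := by
  have h0 : deriv (taylorMonomial a 0) = fun _ => 0 := by
    funext t
    have : taylorMonomial a 0 = fun _ => 1 := by funext t; simp [taylorMonomial]
    rw [this, deriv_const]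
  have hs : ∀ k, deriv (taylorMonomial a (k + 1)) = taylorMonomial a k := by
    intro k
    funext t
    have h : HasDerivAt (taylorMonomial a (k + 1))
        (((k + 1 : ℕ) : ℝ) * (t - a) ^ k * 1 / ((k + 1)! : ℝ)) t := by
      exact (((hasDerivAt_id t).sub_const a).pow (k + 1)).div_const _
    rw [h.deriv, taylorMonomial, Nat.factorial_succ]
    have : (k ! : ℝ) ≠ 0 := by positivity
    have : ((k + 1 : ℕ) : ℝ) ≠ 0 := by positivity
    push_cast at *
    field_simp
  have hz : ∀ j, deriv^[j] (fun _ : ℝ => (0 : ℝ)) = fun _ => 0 := by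
    intro j
    induction j with
    | zero => rfl
    | succ j ih => rw [Function.iterate_succ_apply]; simpa using ih
  induction j generalizing k with
  | zero =>
    cases k with
    | zero => simp [taylorMonomial]
    | succ k => simp [taylorMonomial]
  | succ j ih =>
    rw [Function.iterate_succ_apply]
    cases k with
    | zero => rw [h0, hz]; simp
    | succ k => rw [hs, ih]; simp

lemma exists_contDiff_iterMulti_eq (N : ℕ) (x : Fin n → ℝ) (v : (Fin n → ℕ) → ℝ) :
    ∃ g : (Fin n → ℝ) → ℝ, ContDiff ℝ ∞ g ∧
      ∀ J : Fin n → ℕ, ∑ i, J i ≤ N → iterMulti partialX J g x = v J := by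
  set e : (Fin n → ℕ) → (Fin n → ℝ) → ℝ := fun K y => ∏ j, taylorMonomial (x j) (K j) (y j) with he
  have hes : ∀ K, ContDiff ℝ ∞ (e K) := by
    intro K
    simp only [he, taylorMonomial]
    fun_prop
  refine ⟨fun y => ∑ K ∈ multiIndices n N, v K * e K y, ?_, fun J hJ => ?_⟩
  · exact ContDiff.sum fun K _ => contDiff_const.mul (hes K)
  · rw [iterMulti_partialX_sum isOpen_univ _ v e (fun K _ => (hes K).contDiffOn) J (mem_univ x)]
    simp only [he]
    rw [Finset.sum_eq_single J]
    · rw [iterMulti_partialX_prod]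
      simp [deriv_iterate_taylorMonomial]
    · intro K _ hK
      obtain ⟨i, hi⟩ : ∃ i, K i ≠ J i := by
        by_contra! h
        exact hK (funext h)
      rw [iterMulti_partialX_prod]
      simp only [deriv_iterate_taylorMonomial]
      rw [Finset.prod_eq_zero (Finset.mem_univ i) (by simp [hi.symm]), mul_zero]
    · intro h
      exact absurd (mem_multiIndices.2 hJ) h

/-- The jet of `u_{(0)}`. -/
def baseJet (r : ℕ) (z : ExpJet n m p) : Jet n m r := (z.1, fun α J => z.2 (0, α, J.1))

/-- The jets of the coefficients `u_{(0)},…,u_{(p)}` for which the jet of `u_{(0)}` is in `W`. -/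
def jetsOver (p : ℕ) (W : Set (Jet n m r)) : Set (ExpJet n m p) := baseJet r ⁻¹' W

lemma isOpen_jetsOver {W : Set (Jet n m r)} (hW : IsOpen W) : IsOpen (jetsOver p W) := by
  refine hW.preimage ?_
  unfold baseJet
  fun_prop

/-- Every jet of finite order over `W` is the jet of an admissible family of functions. -/
lemma exists_admissible {W : Set (Jet n m r)} (hW : IsOpen W) {z : ExpJet n m p}
    (hz : z ∈ jetsOver p W) (N : ℕ) :
    ∃ V u, Admissible p W V u ∧ z.1 ∈ V ∧ restr N (expJetOf u z.1) = restr N z := by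
  choose u hu hJ using fun (k : Fin (p + 1)) (α : Fin m) =>
    exists_contDiff_iterMulti_eq (max r N) z.1 (fun J => z.2 (k, α, J))
  have hc : Continuous (jetOf r (u 0)) := by
    rw [← continuousOn_univ]
    exact continuousOn_jetOf isOpen_univ (fun α => (hu 0 α).contDiffOn) r
  refine ⟨jetOf r (u 0) ⁻¹' W, u, ⟨hW.preimage hc, fun k α => (hu k α).contDiffOn,
    fun x hx => hx⟩, ?_, ?_⟩
  · have : jetOf r (u 0) z.1 = baseJet r z := by
      refine Prod.ext rfl ?_
      funext α J
      exact hJ 0 α J.1 (J.2.trans (le_max_left _ _))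
    rw [mem_preimage, this]
    exact hz
  · refine Prod.ext rfl ?_
    funext c
    exact hJ c.1 c.2.1 c.2.2.1 (c.2.2.2.trans (le_max_right _ _))

lemma expJetOf_mem_jetsOver {W : Set (Jet n m r)} {V : Set (Fin n → ℝ)}
    {u : Fin (p + 1) → Fin m → (Fin n → ℝ) → ℝ} (hu : Admissible p W V u) {x : Fin n → ℝ}
    (hx : x ∈ V) : expJetOf u x ∈ jetsOver p W := hu.jet_mem x hx

/-- A function of finitely many jet variables that vanishes on all jets of admissible families
vanishes. -/
lemma eqOn_of_admissible {W : Set (Jet n m r)} (hW : IsOpen W) {N : ℕ} {F G : ExpJet n m p → ℝ}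
    (hF : IsJetFunOn (jetsOver p W) N F) (hG : IsJetFunOn (jetsOver p W) N G)
    (h : ∀ V u, Admissible p W V u → ∀ x ∈ V, F (expJetOf u x) = G (expJetOf u x)) :
    EqOn F G (jetsOver p W) := by
  intro z hz
  obtain ⟨V, u, hu, hx, hzu⟩ := exists_admissible hW hz N
  have hmem := expJetOf_mem_jetsOver hu hx
  obtain ⟨f, -, hF⟩ := hF
  obtain ⟨g, -, hG⟩ := hG
  have := h V u hu _ hx
  rw [hF hmem, hG hmem] at this
  rw [hF hz, hG hz]
  simpa [hzu] using this

end

section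

/-! ### Integrals depending smoothly on parameters -/

lemma continuousOn_slice
    {E G : Type} [TopologicalSpace E] [TopologicalSpace G] {f : E × ℝ → G} {y : E}
    (hf : ∀ l ∈ Icc (0 : ℝ) 1, ContinuousAt f (y, l)) :
    ContinuousOn (fun l => f (y, l)) (Icc (0 : ℝ) 1) := fun l hl =>
  (ContinuousAt.comp (f := fun l : ℝ => (y, l)) (hf l hl) (by fun_prop)).continuousWithinAt

lemma intervalIntegrable_slice {E G : Type} [TopologicalSpace E] [NormedAddCommGroup G]
    {f : E × ℝ → G} {y : E}
    (hf : ∀ l ∈ Icc (0 : ℝ) 1, ContinuousAt f (y, l)) :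
    IntervalIntegrable (fun l => f (y, l)) MeasureTheory.volume 0 1 :=
  ContinuousOn.intervalIntegrable (by simpa using continuousOn_slice hf)

variable {E G : Type} [NormedAddCommGroup E] [NormedSpace ℝ E] [NormedAddCommGroup G]
  [NormedSpace ℝ G]

/-- The partial derivative with respect to the parameter. -/
noncomputable def paramDeriv (f : E × ℝ → G) (q : E × ℝ) : E →L[ℝ] G :=
  (fderiv ℝ f q).comp (ContinuousLinearMap.inl ℝ E ℝ)

lemma ContDiffAt.paramDeriv {f : E × ℝ → G} {q : E × ℝ} {k l : ℕ∞ω} (hf : ContDiffAt ℝ l f q)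
    (h : k + 1 ≤ l) : ContDiffAt ℝ k (paramDeriv f) q :=
  (hf.fderiv_right h).clm_comp contDiffAt_const

lemma hasFDerivAt_slice {f : E × ℝ → G} {y : E} {l : ℝ} (hf : DifferentiableAt ℝ f (y, l)) :
    HasFDerivAt (fun y => f (y, l)) (paramDeriv f (y, l)) y :=
  hf.hasFDerivAt.comp y (hasFDerivAt_prodMk_left y l)

lemma eventually_forall_contDiffAt {k : ℕ} {f : E × ℝ → G} {y : E}
    (hf : ∀ l ∈ Icc (0 : ℝ) 1, ContDiffAt ℝ k f (y, l)) :
    ∀ᶠ y' in 𝓝 y, ∀ l ∈ Icc (0 : ℝ) 1, ContDiffAt ℝ k f (y', l) :=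
  isCompact_Icc.eventually_forall_of_forall_eventually fun l hl =>
    (hf l hl).eventually (by simp)

lemma hasFDerivAt_integral [CompleteSpace G] {f : E × ℝ → G} {y : E}
    (hf : ∀ l ∈ Icc (0 : ℝ) 1, ContDiffAt ℝ 1 f (y, l)) :
    HasFDerivAt (fun y => ∫ l in (0 : ℝ)..1, f (y, l))
      (∫ l in (0 : ℝ)..1, paramDeriv f (y, l)) y := by
  have hcont : ∀ q, ContDiffAt ℝ 1 f q → ContinuousAt (paramDeriv f) q := fun q hq =>
    (ContDiffAt.paramDeriv (k := 0) hq (by simp)).continuousAt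
  have hev := eventually_forall_contDiffAt (k := 1) hf
  obtain ⟨C, hC⟩ := isCompact_Icc.exists_bound_of_continuousOn
    (continuousOn_slice fun l hl => hcont _ (hf l hl))
  have hbound : ∀ᶠ y' in 𝓝 y, ∀ l ∈ Icc (0 : ℝ) 1, ‖paramDeriv f (y', l)‖ ≤ C + 1 := by
    refine isCompact_Icc.eventually_forall_of_forall_eventually fun l hl => ?_
    have h1 := (hcont _ (hf l hl)).norm.eventually (gt_mem_nhds
      (lt_of_le_of_lt (hC l hl) (lt_add_one C)))
    exact h1.mono fun q hq => le_of_lt hq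
  have hmem : ∀ t ∈ uIoc (0 : ℝ) 1, t ∈ Icc (0 : ℝ) 1 := fun t ht => by
    rw [uIoc_of_le zero_le_one] at ht
    exact ⟨ht.1.le, ht.2⟩
  have hs := hev.and hbound
  refine intervalIntegral.hasFDerivAt_integral_of_dominated_of_fderiv_le
    (F := fun y l => f (y, l)) (F' := fun y l => paramDeriv f (y, l)) (bound := fun _ => C + 1)
    hs ?_ ?_ ?_ ?_ ?_ ?_
  · filter_upwards [hev] with y' hy'
    exact (intervalIntegrable_slice fun l hl => (hy' l hl).continuousAt).def'.aestronglyMeasurable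
  · exact intervalIntegrable_slice fun l hl => (hf l hl).continuousAt
  · exact (intervalIntegrable_slice fun l hl =>
      hcont _ (hf l hl)).def'.aestronglyMeasurable
  · exact Eventually.of_forall fun t ht y' hy' => hy'.2 t (hmem t ht)
  · exact intervalIntegrable_const
  · exact Eventually.of_forall fun t ht y' hy' =>
      hasFDerivAt_slice ((hy'.1 t (hmem t ht)).differentiableAt (by simp))

lemma contDiffAt_integral_of_succ (k : ℕ) :
    ∀ {G : Type} [NormedAddCommGroup G] [NormedSpace ℝ G] [CompleteSpace G]
      {f : E × ℝ → G} {y : E},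
    (∀ l ∈ Icc (0 : ℝ) 1, ContDiffAt ℝ (k + 1 : ℕ) f (y, l)) →
      ContDiffAt ℝ k (fun y => ∫ l in (0 : ℝ)..1, f (y, l)) y := by
  induction k with
  | zero =>
    intro G _ _ _ f y hf
    refine contDiffAt_zero.2 ⟨_, eventually_forall_contDiffAt hf, fun y' hy' => ?_⟩
    exact (hasFDerivAt_integral fun l hl => by simpa using hy' l hl).continuousAt.continuousWithinAt
  | succ k ih =>
    intro G _ _ _ f y hf
    refine contDiffAt_succ_iff_hasFDerivAt.2 ⟨fun y => ∫ l in (0 : ℝ)..1, paramDeriv f (y, l),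
      ⟨_, eventually_forall_contDiffAt hf, fun y' hy' => ?_⟩, ?_⟩
    · exact hasFDerivAt_integral fun l hl => (hy' l hl).of_le (by
        push_cast
        exact le_add_self)
    · exact ih fun l hl => ContDiffAt.paramDeriv (hf l hl) (by push_cast; rfl)

lemma contDiffAt_integral [CompleteSpace G] {f : E × ℝ → G} {y : E}
    (hf : ∀ l ∈ Icc (0 : ℝ) 1, ContDiffAt ℝ ∞ f (y, l)) :
    ContDiffAt ℝ ∞ (fun y => ∫ l in (0 : ℝ)..1, f (y, l)) y :=
  contDiffAt_infty.2 fun k => contDiffAt_integral_of_succ k fun l hl =>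
    contDiffAt_infty.1 (hf l hl) _

lemma fderiv_integral_apply {f : E × ℝ → ℝ} {y : E}
    (hf : ∀ l ∈ Icc (0 : ℝ) 1, ContDiffAt ℝ ∞ f (y, l)) (v : E) :
    fderiv ℝ (fun y => ∫ l in (0 : ℝ)..1, f (y, l)) y v
      = ∫ l in (0 : ℝ)..1, fderiv ℝ f (y, l) (v, 0) := by
  have hf1 : ∀ l ∈ Icc (0 : ℝ) 1, ContDiffAt ℝ 1 f (y, l) := fun l hl => (hf l hl).of_le (by simp)
  rw [(hasFDerivAt_integral hf1).fderiv, ContinuousLinearMap.intervalIntegral_apply]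
  · rfl
  · exact intervalIntegrable_slice fun l hl =>
      (ContDiffAt.paramDeriv (k := 0) (hf1 l hl) (by simp)).continuousAt

/-! ### Smooth functions on star-shaped sets are divergences -/

/-- On an open set that is star-shaped about `x₀`, `g` is the divergence of the field
`(x - x₀) ∫₀¹ λⁿ⁻¹ g(x₀ + λ(x - x₀)) dλ`. -/
lemma exists_sum_partialX_eq {n : ℕ} (hn : 0 < n) {X : Set (Fin n → ℝ)} (hX : IsOpen X)
    {x₀ : Fin n → ℝ} (hstar : StarConvex ℝ x₀ X) {g : (Fin n → ℝ) → ℝ}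
    (hg : ∀ x ∈ X, ContDiffAt ℝ ∞ g x) :
    ∃ P : Fin n → (Fin n → ℝ) → ℝ, (∀ i, ∀ x ∈ X, ContDiffAt ℝ ∞ (P i) x) ∧
      ∀ x ∈ X, ∑ i, partialX i (P i) x = g x := by
  obtain ⟨d, rfl⟩ : ∃ d, n = d + 1 := ⟨n - 1, by omega⟩
  set e : (Fin (d + 1) → ℝ) × ℝ → Fin (d + 1) → ℝ := fun q => x₀ + q.2 • (q.1 - x₀) with he
  have hes : ContDiff ℝ ∞ e := by simp only [he]; fun_prop
  have hmem : ∀ x ∈ X, ∀ l ∈ Icc (0 : ℝ) 1, e (x, l) ∈ X := fun x hx l hl =>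
    hstar.add_smul_sub_mem hx hl.1 hl.2
  have hge : ∀ x ∈ X, ∀ l ∈ Icc (0 : ℝ) 1, ContDiffAt ℝ ∞ (fun q => g (e q)) (x, l) :=
    fun x hx l hl => (hg _ (hmem x hx l hl)).comp (x, l) hes.contDiffAt
  set f : Fin (d + 1) → (Fin (d + 1) → ℝ) × ℝ → ℝ :=
    fun i q => q.2 ^ d * (q.1 i - x₀ i) * g (e q) with hf
  have hfs : ∀ i, ∀ x ∈ X, ∀ l ∈ Icc (0 : ℝ) 1, ContDiffAt ℝ ∞ (f i) (x, l) := by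
    intro i x hx l hl
    refine ContDiffAt.mul (ContDiff.contDiffAt ?_) (hge x hx l hl)
    fun_prop
  refine ⟨fun i x => ∫ l in (0 : ℝ)..1, f i (x, l),
    fun i x hx => contDiffAt_integral (hfs i x hx), fun x hx => ?_⟩
  have h1 : ∀ i, partialX i (fun x => ∫ l in (0 : ℝ)..1, f i (x, l)) x
      = ∫ l in (0 : ℝ)..1, fderiv ℝ (f i) (x, l) (Pi.single i 1, 0) := by
    intro i
    rw [partialX_eq_fderiv i ((contDiffAt_integral (hfs i x hx)).differentiableAt (by simp)),
      fderiv_integral_apply (hfs i x hx)]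
  simp only [h1]
  have hint : ∀ i, IntervalIntegrable (fun l => fderiv ℝ (f i) (x, l) (Pi.single i 1, 0))
      MeasureTheory.volume 0 1 := fun i =>
    intervalIntegrable_slice (f := fun q => fderiv ℝ (f i) q (Pi.single i 1, 0)) fun l hl =>
      (((hfs i x hx l hl).fderiv_right (m := ∞) (by simp)).clm_apply contDiffAt_const).continuousAt
  rw [← intervalIntegral.integral_finsetSum fun i _ => hint i]
  have hderiv : ∀ l ∈ uIcc (0 : ℝ) 1, HasDerivAt (fun l => l ^ (d + 1) * g (e (x, l)))
      (∑ i, fderiv ℝ (f i) (x, l) (Pi.single i 1, 0)) l := by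
    intro l hl
    rw [uIcc_of_le zero_le_one] at hl
    have hgd : HasFDerivAt g (fderiv ℝ g (e (x, l))) (e (x, l)) :=
      ((hg _ (hmem x hx l hl)).differentiableAt (by simp)).hasFDerivAt
    have hfi : ∀ i, fderiv ℝ (f i) (x, l) (Pi.single i 1, 0)
        = l ^ d * g (e (x, l))
          + l ^ (d + 1) * (fderiv ℝ g (e (x, l)) ((x i - x₀ i) • Pi.single i 1)) := by
      intro i
      have hcurve : HasDerivAt (fun t : ℝ => ((x + t • Pi.single i 1, l) : (Fin (d + 1) → ℝ) × ℝ))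
          (Pi.single i 1, 0) 0 := by
        have := (((hasDerivAt_id (0 : ℝ)).smul_const (Pi.single i 1 : Fin (d + 1) → ℝ)).const_add
          x).prodMk (hasDerivAt_const (0 : ℝ) l)
        simpa using this
      have hecurve : HasDerivAt (fun t : ℝ => e (x + t • Pi.single i 1, l))
          (l • Pi.single i 1) 0 := by
        have := ((((hasDerivAt_id (0 : ℝ)).smul_const
          (Pi.single i 1 : Fin (d + 1) → ℝ)).const_add x).sub_const x₀).const_smul l |>.const_add x₀
        simpa [he] using this
      have h0 : (x + (0 : ℝ) • (Pi.single i 1 : Fin (d + 1) → ℝ), l) = (x, l) := by simp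
      have hA : HasDerivAt (fun t : ℝ => f i (x + t • Pi.single i 1, l))
          (fderiv ℝ (f i) (x, l) (Pi.single i 1, 0)) 0 := by
        have hfd : HasFDerivAt (f i) (fderiv ℝ (f i) (x, l))
            (x + (0 : ℝ) • (Pi.single i 1 : Fin (d + 1) → ℝ), l) := by
          rw [h0]; exact ((hfs i x hx l hl).differentiableAt (by simp)).hasFDerivAt
        exact hfd.comp_hasDerivAt (0 : ℝ) hcurve
      have hgd' : HasFDerivAt g (fderiv ℝ g (e (x, l)))
          (e (x + (0 : ℝ) • (Pi.single i 1 : Fin (d + 1) → ℝ), l)) := by rw [h0]; exact hgd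
      have hB1 : HasDerivAt (fun t : ℝ => g (e (x + t • Pi.single i 1, l)))
          (fderiv ℝ g (e (x, l)) (l • Pi.single i 1)) 0 := hgd'.comp_hasDerivAt (0 : ℝ) hecurve
      have hB2 : HasDerivAt (fun t : ℝ =>
          l ^ d * ((x + t • (Pi.single i 1 : Fin (d + 1) → ℝ)) i - x₀ i)) (l ^ d) 0 := by
        have := (((hasDerivAt_id (0 : ℝ)).const_add (x i)).sub_const (x₀ i)).const_mul (l ^ d)
        simpa using this
      have hB := hB2.mul hB1
      rw [hA.unique hB]
      simp only [zero_smul, add_zero, map_smul, smul_eq_mul]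
      ring
    have hcurve : HasDerivAt (fun l : ℝ => e (x, l)) (x - x₀) l := by
      have := ((hasDerivAt_id l).smul_const (x - x₀)).const_add x₀
      simpa [he] using this
    have h := (hasDerivAt_pow (d + 1) l).mul (hgd.comp_hasDerivAt l hcurve)
    refine h.congr_deriv ?_
    simp only [hfi, Finset.sum_add_distrib, ← Finset.mul_sum, ← map_sum]
    have : ∑ i, (x i - x₀ i) • (Pi.single i 1 : Fin (d + 1) → ℝ) = x - x₀ := by
      ext j
      simp [Finset.sum_apply, Pi.single_apply]
    rw [this]
    simp
    ring
  rw [intervalIntegral.integral_eq_sub_of_hasDerivAt hderiv]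
  · simp [he]
  · have h := IntervalIntegrable.sum Finset.univ fun i _ => hint i
    rwa [Finset.sum_fn] at h

end

section

variable {n m r : ℕ}

/-! ### The homotopy to a fixed map -/

/-- The jet `(1 - λ) j(u⁰) + λ j(u)`. -/
noncomputable def scaleJet (u₀ : Fin m → (Fin n → ℝ) → ℝ) (l : ℝ) (z : ExpJet n m 0) :
    ExpJet n m 0 :=
  (z.1, fun c => (1 - l) * iterMulti partialX c.2.2 (u₀ c.2.1) z.1 + l * z.2 c)

/-- `scaleJet` on jets of finite order, as a function of the jet and of `λ`. -/
noncomputable def finScaleJet (u₀ : Fin m → (Fin n → ℝ) → ℝ) (N : ℕ) (q : FinJet n m 0 N × ℝ) :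
    FinJet n m 0 N :=
  (q.1.1, fun c => (1 - q.2) * iterMulti partialX c.2.2.1 (u₀ c.2.1) q.1.1 + q.2 * q.1.2 c)

/-- The average of `H` over the segment that joins the jet of `u⁰` to the given jet. -/
noncomputable def homotopyIntegral (u₀ : Fin m → (Fin n → ℝ) → ℝ) (H : ExpJet n m 0 → ℝ)
    (z : ExpJet n m 0) : ℝ :=
  ∫ l in (0 : ℝ)..1, H (scaleJet u₀ l z)

lemma contDiffAt_finScaleJet {X : Set (Fin n → ℝ)} (hX : IsOpen X)
    {u₀ : Fin m → (Fin n → ℝ) → ℝ} (hu : ∀ α, ContDiffOn ℝ ∞ (u₀ α) X) {N : ℕ}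
    {q : FinJet n m 0 N × ℝ} (hq : q.1.1 ∈ X) : ContDiffAt ℝ ∞ (finScaleJet u₀ N) q := by
  unfold finScaleJet
  refine ContDiffAt.prodMk (by fun_prop) (contDiffAt_pi.2 fun c => ?_)
  have h1 : ContDiffAt ℝ ∞ (fun q : FinJet n m 0 N × ℝ =>
      iterMulti partialX c.2.2.1 (u₀ c.2.1) q.1.1) q :=
    ((contDiffOn_iterMulti hX (hu c.2.1) c.2.2.1).contDiffAt (hX.mem_nhds hq)).comp q (by fun_prop)
  refine ContDiffAt.add (ContDiffAt.mul (by fun_prop) h1) (ContDiff.contDiffAt ?_)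
  fun_prop

lemma scaleJet_mem {W : Set (Jet n m r)} {u₀ : Fin m → (Fin n → ℝ) → ℝ}
    (hseg : ∀ z ∈ W, segment ℝ (jetOf r u₀ z.1) z ⊆ W) {z : ExpJet n m 0} (hz : z ∈ jetsOver 0 W)
    {l : ℝ} (hl : l ∈ Icc (0 : ℝ) 1) :
    scaleJet u₀ l z ∈ jetsOver 0 W := by
  refine hseg _ hz ⟨1 - l, l, by linarith [hl.2], hl.1, by ring, ?_⟩
  refine Prod.ext ?_ ?_
  · funext i
    simp only [jetOf, baseJet, scaleJet, Prod.fst_add, Prod.smul_fst, Pi.add_apply, Pi.smul_apply,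
      smul_eq_mul]
    ring
  · funext α J
    simp [jetOf, baseJet, scaleJet]

lemma homotopyIntegral_eqOn {W : Set (Jet n m r)} {u₀ : Fin m → (Fin n → ℝ) → ℝ}
    (hseg : ∀ z ∈ W, segment ℝ (jetOf r u₀ z.1) z ⊆ W) {N : ℕ} {H : ExpJet n m 0 → ℝ}
    {h : FinJet n m 0 N → ℝ} (hH : EqOn H (h ∘ restr N) (jetsOver 0 W)) :
    EqOn (homotopyIntegral u₀ H)
      ((fun y => ∫ l in (0 : ℝ)..1, h (finScaleJet u₀ N (y, l))) ∘ restr N) (jetsOver 0 W) := by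
  intro z hz
  refine intervalIntegral.integral_congr fun l hl => ?_
  rw [uIcc_of_le zero_le_one] at hl
  exact hH (scaleJet_mem hseg hz hl)

section

variable {W : Set (Jet n m r)} (hW : IsOpen W) {u₀ : Fin m → (Fin n → ℝ) → ℝ}
  (hu : ∀ α, ContDiffOn ℝ ∞ (u₀ α) (Prod.fst '' W))
  (hseg : ∀ z ∈ W, segment ℝ (jetOf r u₀ z.1) z ⊆ W) {N : ℕ} {H : ExpJet n m 0 → ℝ}
include hW hu hseg

lemma contDiffAt_comp_finScaleJet {h : FinJet n m 0 N → ℝ}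
    (hh : ∀ z ∈ jetsOver 0 W, ContDiffAt ℝ ∞ h (restr N z)) {z : ExpJet n m 0}
    (hz : z ∈ jetsOver 0 W) {l : ℝ} (hl : l ∈ Icc (0 : ℝ) 1) :
    ContDiffAt ℝ ∞ (fun q => h (finScaleJet u₀ N q)) (restr N z, l) :=
  ContDiffAt.comp (g := h) _ (hh _ (scaleJet_mem hseg hz hl))
    (contDiffAt_finScaleJet (isOpenMap_fst _ hW) hu ⟨_, hz, rfl⟩)

lemma isJetFunOn_homotopyIntegral (hH : IsJetFunOn (jetsOver 0 W) N H) :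
    IsJetFunOn (jetsOver 0 W) N (homotopyIntegral u₀ H) := by
  obtain ⟨h, hh, hH⟩ := hH
  exact ⟨_, fun z hz => contDiffAt_integral fun l hl =>
    contDiffAt_comp_finScaleJet hW hu hseg hh hz hl, homotopyIntegral_eqOn hseg hH⟩

lemma continuousOn_comp_scaleJet (hH : IsJetFunOn (jetsOver 0 W) N H) {z : ExpJet n m 0}
    (hz : z ∈ jetsOver 0 W) : ContinuousOn (fun l => H (scaleJet u₀ l z)) (Icc 0 1) := by
  obtain ⟨h, hh, hH⟩ := hH
  refine (continuousOn_slice (f := fun q => h (finScaleJet u₀ N q)) (y := restr N z) fun l hl =>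
    (contDiffAt_comp_finScaleJet hW hu hseg hh hz hl).continuousAt).congr fun l hl => ?_
  exact hH (scaleJet_mem hseg hz hl)

/-- Total derivatives commute with the homotopy integral, since `scaleJet` maps jets of functions
to jets of functions. -/
lemma totalDeriv_homotopyIntegral (hH : IsJetFunOn (jetsOver 0 W) N H) (i : Fin n) :
    EqOn (totalDeriv i (homotopyIntegral u₀ H)) (homotopyIntegral u₀ (totalDeriv i H))
      (jetsOver 0 W) := by
  intro z hz
  have hU : IsOpen (jetsOver 0 W) := isOpen_jetsOver hW
  have hX : IsOpen (Prod.fst '' W) := isOpenMap_fst _ hW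
  have hzX : z.1 ∈ Prod.fst '' W := ⟨_, hz, rfl⟩
  rw [totalDeriv_eq_lineDeriv hU (isJetFunOn_homotopyIntegral hW hu hseg hH) i hz]
  have hH' := hH
  obtain ⟨h, hh, hH⟩ := hH
  have hs := fun l hl => contDiffAt_comp_finScaleJet hW hu hseg hh hz (l := l) hl
  rw [lineDeriv_of_eqOn hU hz ((contDiffAt_integral hs).differentiableAt (by simp))
    (homotopyIntegral_eqOn hseg hH), fderiv_integral_apply hs]
  refine intervalIntegral.integral_congr fun l hl => ?_
  rw [uIcc_of_le zero_le_one] at hl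
  have hzl := scaleJet_mem hseg hz hl
  rw [totalDeriv_eq_lineDeriv hU hH' i hzl,
    lineDeriv_of_eqOn hU hzl ((hh _ hzl).differentiableAt (by simp)) hH]
  have hcurve : HasDerivAt (fun t : ℝ => (restr N (z + t • totalVec i z), l))
      (restr N (totalVec i z), 0) 0 :=
    (hasDerivAt_restr_line N z _ 0).prodMk (hasDerivAt_const _ _)
  have h0 : restr N (z + (0 : ℝ) • totalVec i z) = restr N z := by simp
  have hA : HasDerivAt (fun t : ℝ => h (finScaleJet u₀ N (restr N (z + t • totalVec i z), l)))
      (fderiv ℝ (fun q => h (finScaleJet u₀ N q)) (restr N z, l) (restr N (totalVec i z), 0)) 0 := by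
    have hfd : HasFDerivAt (fun q => h (finScaleJet u₀ N q))
        (fderiv ℝ (fun q => h (finScaleJet u₀ N q)) (restr N z, l))
        (restr N (z + (0 : ℝ) • totalVec i z), l) := by
      rw [h0]; exact ((hs l hl).differentiableAt (by simp)).hasFDerivAt
    exact hfd.comp_hasDerivAt (0 : ℝ) hcurve
  have hsc : HasDerivAt (fun t : ℝ => finScaleJet u₀ N (restr N (z + t • totalVec i z), l))
      (restr N (totalVec i (scaleJet u₀ l z))) 0 := by
    refine HasDerivAt.prodMk ?_ (hasDerivAt_pi.2 fun c => ?_)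
    · simpa [totalVec] using
        ((hasDerivAt_id (0 : ℝ)).smul_const (Pi.single i 1 : Fin n → ℝ)).const_add z.1
    · have hj : HasDerivAt (fun t : ℝ => iterMulti partialX c.2.2.1 (u₀ c.2.1)
          (z.1 + t • Pi.single i 1))
          (iterMulti partialX (c.2.2.1 + Pi.single i 1) (u₀ c.2.1) z.1) 0 := by
        have hd : DifferentiableAt ℝ (iterMulti partialX c.2.2.1 (u₀ c.2.1)) z.1 :=
          ((contDiffOn_iterMulti hX (hu c.2.1) c.2.2.1).contDiffAt
            (hX.mem_nhds hzX)).differentiableAt (by simp)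
        rw [(commutingOn_partialX hX).iterMulti_add_single _ i (hu c.2.1) hzX,
          partialX_eq_fderiv i hd]
        have hd' : HasFDerivAt (iterMulti partialX c.2.2.1 (u₀ c.2.1))
            (fderiv ℝ (iterMulti partialX c.2.2.1 (u₀ c.2.1)) z.1)
            (z.1 + (0 : ℝ) • (Pi.single i 1 : Fin n → ℝ)) := by simpa using hd.hasFDerivAt
        have hl : HasDerivAt (fun t : ℝ => z.1 + t • (Pi.single i 1 : Fin n → ℝ))
            (Pi.single i 1) 0 := by
          simpa using ((hasDerivAt_id (0 : ℝ)).smul_const (Pi.single i 1 : Fin n → ℝ)).const_add z.1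
        exact hd'.comp_hasDerivAt (0 : ℝ) hl
      have hlin : HasDerivAt (fun t : ℝ => z.2 c.toCoord + t * z.2 (c.toCoord.shift i))
          (z.2 (c.toCoord.shift i)) 0 := by
        simpa using ((hasDerivAt_id (0 : ℝ)).mul_const (z.2 (c.toCoord.shift i))).const_add
          (z.2 c.toCoord)
      exact (hj.const_mul (1 - l)).add (hlin.const_mul l)
  have hB : HasDerivAt (fun t : ℝ => h (finScaleJet u₀ N (restr N (z + t • totalVec i z), l)))
      (fderiv ℝ h (restr N (scaleJet u₀ l z)) (restr N (totalVec i (scaleJet u₀ l z)))) 0 := by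
    have hfd : HasFDerivAt h (fderiv ℝ h (restr N (scaleJet u₀ l z)))
        (finScaleJet u₀ N (restr N (z + (0 : ℝ) • totalVec i z), l)) := by
      rw [h0]; exact ((hh _ hzl).differentiableAt (by simp)).hasFDerivAt
    exact hfd.comp_hasDerivAt (0 : ℝ) hsc
  exact hA.unique hB

lemma iterMulti_homotopyIntegral (hH : IsJetFunOn (jetsOver 0 W) N H) (J : Fin n → ℕ) :
    EqOn (iterMulti totalDeriv J (homotopyIntegral u₀ H))
      (homotopyIntegral u₀ (iterMulti totalDeriv J H)) (jetsOver 0 W) :=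
  (commutingOn_totalDeriv (isOpen_jetsOver hW)).iterMulti_transform _
    (fun i _ ⟨_, hg⟩ => totalDeriv_homotopyIntegral hW hu hseg hg i) J ⟨N, hH⟩

/-- The difference of the values of `F` at the ends of the segment. -/
lemma sub_scaleJet_zero {F : ExpJet n m 0 → ℝ} (hF : IsJetFunOn (jetsOver 0 W) N F)
    {z : ExpJet n m 0} (hz : z ∈ jetsOver 0 W) :
    F z - F (scaleJet u₀ 0 z) = ∑ c : FinCoord n m 0 N,
      (z.2 c.toCoord - iterMulti partialX c.2.2.1 (u₀ c.2.1) z.1)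
        * homotopyIntegral u₀ (partialU c.toCoord F) z := by
  have hU : IsOpen (jetsOver 0 W) := isOpen_jetsOver hW
  set w : FinCoord n m 0 N → ℝ :=
    fun c => z.2 c.toCoord - iterMulti partialX c.2.2.1 (u₀ c.2.1) z.1 with hw
  have hd : ∀ l ∈ uIcc (0 : ℝ) 1, HasDerivAt (fun l => F (scaleJet u₀ l z))
      (∑ c, w c * partialU c.toCoord F (scaleJet u₀ l z)) l := by
    intro l hl
    rw [uIcc_of_le zero_le_one] at hl
    have hzl := scaleJet_mem hseg hz hl
    set ξ : ExpJet n m 0 :=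
      (0, fun c => z.2 c - iterMulti partialX c.2.2 (u₀ c.2.1) z.1) with hξ
    have hline : ∀ t, scaleJet u₀ t z = scaleJet u₀ l z + (t - l) • ξ := by
      intro t
      ext j
      · simp [scaleJet, hξ]
      · simp only [scaleJet, hξ, Prod.snd_add, Prod.smul_snd, Pi.add_apply, Pi.smul_apply,
          smul_eq_mul]
        ring
    have h1 := (hF.lineDifferentiableAt hU hzl ξ).hasLineDerivAt
    have h2 : HasDerivAt (fun t => F (scaleJet u₀ t z)) (lineDeriv ℝ F (scaleJet u₀ l z) ξ) l := by
      have h3 : HasDerivAt (fun t : ℝ => F (scaleJet u₀ l z + t • ξ))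
          (lineDeriv ℝ F (scaleJet u₀ l z) ξ) (l - l) := by rw [sub_self]; exact h1
      have h4 := HasDerivAt.comp_sub_const l l h3
      simpa only [← hline] using h4
    convert h2 using 1
    obtain ⟨f, hf, hFf⟩ := hF
    simp only [partialU_eq_lineDeriv,
      lineDeriv_of_eqOn hU hzl ((hf _ hzl).differentiableAt (by simp)) hFf]
    have : restr N ξ = ∑ c, w c • restr N (coordVec (FinCoord.toCoord c)) := by
      simp only [restr_coordVec_toCoord]
      ext j
      · simp [hξ, Prod.fst_sum]
      · simp only [hξ, hw, Prod.snd_sum, Finset.sum_apply, Prod.smul_snd, Pi.smul_apply,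
          Pi.single_apply, restr_snd, smul_eq_mul, mul_ite, mul_one, mul_zero, Finset.sum_ite_eq,
          Finset.mem_univ, if_true]
        rfl
    rw [this, map_sum]
    simp
  have hint : ∀ c : FinCoord n m 0 N, IntervalIntegrable
      (fun l => w c * partialU c.toCoord F (scaleJet u₀ l z)) MeasureTheory.volume 0 1 := by
    intro c
    refine ContinuousOn.intervalIntegrable ?_
    rw [uIcc_of_le zero_le_one]
    exact continuousOn_const.mul (continuousOn_comp_scaleJet hW hu hseg (hF.partialU hU _) hz)
  have h1 : scaleJet u₀ 1 z = z := by
    ext j <;> simp [scaleJet]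
  have hint' := IntervalIntegrable.sum Finset.univ fun c _ => hint c
  rw [Finset.sum_fn] at hint'
  have := intervalIntegral.integral_eq_sub_of_hasDerivAt hd hint'
  rw [h1] at this
  rw [← this, intervalIntegral.integral_finsetSum fun c _ => hint c]
  simp only [intervalIntegral.integral_const_mul]
  rfl

/-- A function in the kernel of the Euler operators is a total divergence, if its domain is
star-shaped. -/
lemma isDivergenceOn_of_approxEuler_eq_zero (hn : 0 < n) {x₀ : Fin n → ℝ}
    (hstar : StarConvex ℝ x₀ (Prod.fst '' W)) {F : ExpJet n m 0 → ℝ}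
    (hF : IsJetFunOn (jetsOver 0 W) r F)
    (hE : ∀ α, EqOn (approxEuler r α F) (fun _ => 0) (jetsOver 0 W)) :
    IsDivergenceOn (jetsOver 0 W) F := by
  have hU : IsOpen (jetsOver 0 W) := isOpen_jetsOver hW
  have hX : IsOpen (Prod.fst '' W) := isOpenMap_fst _ hW
  have hzX : ∀ z ∈ jetsOver 0 W, z.1 ∈ Prod.fst '' W := fun z hz => ⟨_, hz, rfl⟩
  set w : Fin m → (Fin n → ℕ) → ExpJet n m 0 → ℝ :=
    fun α J z => z.2 (0, α, J) - iterMulti partialX J (u₀ α) z.1 with hw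
  have hjs : ∀ α J, ∀ z ∈ jetsOver 0 W,
      ContDiffAt ℝ ∞ (iterMulti partialX J (u₀ α)) z.1 := fun α J z hz =>
    (contDiffOn_iterMulti hX (hu α) J).contDiffAt (hX.mem_nhds (hzX z hz))
  have hws : ∀ α J, IsJetFunOn (jetsOver 0 W) (∑ i, J i) (w α J) := by
    intro α J
    have h2 := (IsJetFunOn.of_fst (U := jetsOver (p := 0) W) (N := ∑ i, J i) (hjs α J))
    have := (IsJetFunOn.coord (U := jetsOver (p := 0) W) (N := ∑ i, J i)
      (c := (0, α, J)) le_rfl).add ((IsJetFunOn.const (-1)).mul h2)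
    exact this.congr fun z _ => by simp only [hw]; ring
  -- `Dᵢ w_J = w_{J+eᵢ}`, so that `w_J` can be integrated by parts
  have hwD : ∀ α i J, EqOn (totalDeriv i (w α J)) (w α (J + Pi.single i 1)) (jetsOver 0 W) := by
    intro α i J z hz
    rw [totalDeriv_eq_lineDeriv hU (hws α J) i hz]
    have hd := (hjs α J z hz).differentiableAt (by simp)
    have h1 : HasDerivAt (fun t : ℝ => iterMulti partialX J (u₀ α)
        (z + t • totalVec i z : ExpJet n m 0).1)
        (iterMulti partialX (J + Pi.single i 1) (u₀ α) z.1) 0 := by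
      rw [(commutingOn_partialX hX).iterMulti_add_single _ i (hu α) (hzX z hz),
        partialX_eq_fderiv i hd]
      have hd' : HasFDerivAt (iterMulti partialX J (u₀ α))
          (fderiv ℝ (iterMulti partialX J (u₀ α)) z.1)
          (z + (0 : ℝ) • totalVec i z : ExpJet n m 0).1 := by simpa using hd.hasFDerivAt
      have hl : HasDerivAt (fun t : ℝ => (z + t • totalVec i z : ExpJet n m 0).1)
          (Pi.single i 1) 0 := by
        simpa [totalVec] using
          ((hasDerivAt_id (0 : ℝ)).smul_const (Pi.single i 1 : Fin n → ℝ)).const_add z.1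
      exact hd'.comp_hasDerivAt (0 : ℝ) hl
    have h2 : HasDerivAt (fun t : ℝ => (z + t • totalVec i z : ExpJet n m 0).2 (0, α, J))
        (z.2 (0, α, J + Pi.single i 1)) 0 := by
      simpa [totalVec, Coord.shift] using ((hasDerivAt_id (0 : ℝ)).mul_const
        (z.2 (0, α, J + Pi.single i 1))).const_add (z.2 (0, α, J))
    exact (h2.sub h1).deriv
  -- the value at the jet of `u⁰` is a function of `x` alone
  have hbase : IsDivergenceOn (jetsOver 0 W) (fun z => F (scaleJet u₀ 0 z)) := by
    obtain ⟨f, hf, hFf⟩ := hF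
    set g : (Fin n → ℝ) → ℝ := fun x => f (finScaleJet u₀ r ((x, 0), 0)) with hg
    have hres : ∀ z : ExpJet n m 0,
        restr r (scaleJet u₀ 0 z) = finScaleJet u₀ r ((z.1, 0), 0) := by
      intro z
      ext j <;> simp [scaleJet, finScaleJet, FinCoord.toCoord]
    have hgs : ∀ x ∈ Prod.fst '' W, ContDiffAt ℝ ∞ g x := by
      rintro _ ⟨y, hy, rfl⟩
      have hz : ((y.1, fun c => if h : ∑ i, c.2.2 i ≤ r then y.2 c.2.1 ⟨c.2.2, h⟩ else 0) :
          ExpJet n m 0) ∈ jetsOver 0 W := by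
        simp only [jetsOver, mem_preimage, baseJet]
        convert hy using 1
        refine Prod.ext rfl ?_
        funext α J
        exact dif_pos J.2
      have h1 := hf _ (scaleJet_mem hseg hz (l := 0) (by simp))
      rw [hres] at h1
      have h2 : ContDiffAt ℝ ∞ (finScaleJet u₀ r) ((y.1, 0), 0) :=
        contDiffAt_finScaleJet hX hu ⟨y, hy, rfl⟩
      exact ContDiffAt.comp y.1 (g := f) h1 (ContDiffAt.comp y.1 (g := finScaleJet u₀ r)
        (f := fun x => ((x, 0), 0)) h2 (by fun_prop))
    obtain ⟨P, hPs, hP⟩ := exists_sum_partialX_eq hn hX hstar hgs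
    refine ⟨0, fun i z => P i z.1, fun i => .of_fst fun z hz => hPs i _ (hzX z hz), fun z hz => ?_⟩
    have htd : ∀ i, totalDeriv i (fun z : ExpJet n m 0 => P i z.1) z = partialX i (P i) z.1 := by
      intro i
      simp [totalDeriv, partialU, partialX]
    simp only [htd]
    rw [hP _ (hzX z hz), hFf (scaleJet_mem hseg hz (l := 0) (by simp))]
    simp only [hg, Function.comp, hres]
  have hI : ∀ α J, IsJetFunOn (jetsOver 0 W) r (homotopyIntegral u₀ (partialU (0, α, J) F)) :=
    fun α J => isJetFunOn_homotopyIntegral hW hu hseg (hF.partialU hU _)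
  have hparts : ∀ c ∈ (Finset.univ : Finset (Fin m × MultiIndex n r)),
      IsDivergenceOn (jetsOver 0 W) (fun z => w c.1 c.2.1 z
        * homotopyIntegral u₀ (partialU (0, c.1, c.2.1) F) z
        - (-1 : ℝ) ^ (∑ i, c.2.1 i) * (w c.1 0 z * iterMulti totalDeriv c.2.1
          (homotopyIntegral u₀ (partialU (0, c.1, c.2.1) F)) z)) := fun c _ =>
    isDivergenceOn_by_parts hU (w c.1) (fun J => ⟨_, hws c.1 J⟩) (hwD c.1) c.2.1 ⟨r, hI _ _⟩
  refine (hbase.add hU (IsDivergenceOn.sum hU _ (fun _ => 1) _ hparts)).congr fun z hz => ?_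
  -- the terms left by the integration by parts are the average of `E_α F` over the segment
  have hzero : ∀ α, ∑ J : MultiIndex n r, (-1 : ℝ) ^ (∑ i, J.1 i)
      * (w α 0 z * iterMulti totalDeriv J.1 (homotopyIntegral u₀ (partialU (0, α, J.1) F)) z)
        = 0 := by
    intro α
    have hgood : ∀ J : MultiIndex n r, ∃ N, IsJetFunOn (jetsOver 0 W) N
        (iterMulti totalDeriv J.1 (partialU (0, α, J.1) F)) := fun J =>
      (commutingOn_totalDeriv hU).good_iterMulti J.1 ⟨r, hF.partialU hU _⟩
    have h1 : ∑ J : MultiIndex n r, (-1 : ℝ) ^ (∑ i, J.1 i)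
        * homotopyIntegral u₀ (iterMulti totalDeriv J.1 (partialU (0, α, J.1) F)) z = 0 := by
      simp only [homotopyIntegral, ← intervalIntegral.integral_const_mul]
      rw [← intervalIntegral.integral_finsetSum]
      · rw [intervalIntegral.integral_congr (g := fun _ => (0 : ℝ)) fun l hl => ?_]
        · simp
        · rw [uIcc_of_le zero_le_one] at hl
          exact hE α (scaleJet_mem hseg hz hl)
      · intro J _
        refine ContinuousOn.intervalIntegrable ?_
        rw [uIcc_of_le zero_le_one]
        obtain ⟨N, hN⟩ := hgood J
        exact continuousOn_const.mul (continuousOn_comp_scaleJet hW hu hseg hN hz)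
    calc _ = w α 0 z * ∑ J : MultiIndex n r, (-1 : ℝ) ^ (∑ i, J.1 i)
        * homotopyIntegral u₀ (iterMulti totalDeriv J.1 (partialU (0, α, J.1) F)) z := by
          rw [Finset.mul_sum]
          refine Finset.sum_congr rfl fun J _ => ?_
          rw [iterMulti_homotopyIntegral hW hu hseg (hF.partialU hU _) J.1 hz]
          ring
      _ = 0 := by rw [h1, mul_zero]
  have hmain := sub_scaleJet_zero hW hu hseg hF hz
  rw [Fintype.sum_prod_type, Fin.sum_univ_one] at hmain
  simp only [one_mul]
  rw [Finset.sum_sub_distrib, Fintype.sum_prod_type (f := fun c : Fin m × MultiIndex n r =>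
    (-1 : ℝ) ^ (∑ i, c.2.1 i) * (w c.1 0 z * iterMulti totalDeriv c.2.1
          (homotopyIntegral u₀ (partialU (0, c.1, c.2.1) F)) z)),
    Finset.sum_eq_zero fun α _ => hzero α, sub_zero, ← sub_eq_iff_eq_add', hmain]
  rfl

end

end

section

/-! ### Polynomials of degree `p` that are `O(ε^{p+1})` -/

lemma coeff_eq_zero_of_isBigO (p : ℕ) (a : ℕ → ℝ)
    (h : (fun ε : ℝ => ∑ k ∈ Finset.range (p + 1), ε ^ k * a k) =O[𝓝[≠] 0] fun ε => ε ^ (p + 1)) :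
    ∀ k ∈ Finset.range (p + 1), a k = 0 := by
  induction p generalizing a with
  | zero =>
    have h1 : Tendsto (fun ε : ℝ => ε ^ (0 + 1)) (𝓝[≠] 0) (𝓝 0) := by
      have : Continuous fun ε : ℝ => ε ^ (0 + 1) := by fun_prop
      simpa using (this.tendsto 0).mono_left nhdsWithin_le_nhds
    have h2 := h.trans_tendsto h1
    simp only [zero_add, Finset.sum_range_one, pow_zero, one_mul] at h2
    simpa using tendsto_nhds_unique tendsto_const_nhds h2
  | succ p ih =>
    have h0 : a 0 = 0 := by
      have h1 : Tendsto (fun ε : ℝ => ε ^ (p + 1 + 1)) (𝓝[≠] 0) (𝓝 0) := by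
        have : Continuous fun ε : ℝ => ε ^ (p + 1 + 1) := by fun_prop
        simpa using (this.tendsto 0).mono_left nhdsWithin_le_nhds
      have h2 := h.trans_tendsto h1
      have h3 : Tendsto (fun ε : ℝ => ∑ k ∈ Finset.range (p + 1 + 1), ε ^ k * a k) (𝓝[≠] 0)
          (𝓝 (a 0)) := by
        have : Continuous fun ε : ℝ => ∑ k ∈ Finset.range (p + 1 + 1), ε ^ k * a k := by fun_prop
        have h4 := (this.tendsto 0).mono_left (nhdsWithin_le_nhds (s := {0}ᶜ))
        rw [Finset.sum_range_succ'] at h4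
        simpa using h4
      exact tendsto_nhds_unique h3 h2
    have h1 : (fun ε : ℝ => ∑ k ∈ Finset.range (p + 1), ε ^ k * a (k + 1)) =O[𝓝[≠] 0]
        fun ε => ε ^ (p + 1) := by
      refine ((isBigO_refl (fun ε : ℝ => ε⁻¹) (𝓝[≠] 0)).mul h).congr' ?_ ?_
      · filter_upwards [self_mem_nhdsWithin] with ε hε
        have hε : ε ≠ 0 := hε
        rw [Finset.sum_range_succ', h0, mul_zero, add_zero, Finset.mul_sum]
        refine Finset.sum_congr rfl fun k _ => ?_
        field_simp
        ring
      · filter_upwards [self_mem_nhdsWithin] with ε hε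
        have hε : ε ≠ 0 := hε
        field_simp
        ring
    intro k hk
    cases k with
    | zero => exact h0
    | succ k => exact ih _ h1 k (by simpa using hk)

lemma isBigO_pow_iff (p : ℕ) (a : ℕ → ℝ) :
    ((fun ε : ℝ => ∑ k ∈ Finset.range (p + 1), ε ^ k * a k) =O[𝓝 0] fun ε => ε ^ (p + 1)) ↔
      ∀ k ∈ Finset.range (p + 1), a k = 0 := by
  refine ⟨fun h => coeff_eq_zero_of_isBigO p a (h.mono nhdsWithin_le_nhds), fun h => ?_⟩
  have : (fun ε : ℝ => ∑ k ∈ Finset.range (p + 1), ε ^ k * a k) = fun _ => 0 := by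
    funext ε
    exact Finset.sum_eq_zero fun k hk => by rw [h k hk, mul_zero]
  rw [this]
  exact isBigO_zero _ _

/-! ### Derivatives with respect to a parameter -/

/-- The derivative in the fixed direction `v`. -/
noncomputable def dirDeriv {E : Type} [NormedAddCommGroup E] [NormedSpace ℝ E] (v : E)
    (g : E → ℝ) : E → ℝ := fun q => fderiv ℝ g q v

section

variable {E : Type} [NormedAddCommGroup E] [NormedSpace ℝ E] {O : Set E} {g : E → ℝ}

lemma commutingOn_dirDeriv (hO : IsOpen O) {k : ℕ} (v : Fin k → E) :
    CommutingOn (fun i => dirDeriv (v i)) O (fun g => ContDiffOn ℝ ∞ g O) := by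
  refine ⟨fun i g hg => ?_, fun i g h hgh q hq => ?_, fun i j g hg q hq => ?_⟩
  · exact (hg.fderiv_of_isOpen (m := ∞) hO (by simp)).clm_apply contDiffOn_const
  · have : g =ᶠ[𝓝 q] h := hgh.eventuallyEq_of_mem (hO.mem_nhds hq)
    simp only [dirDeriv, this.fderiv_eq]
  · have hf := hg.contDiffAt (hO.mem_nhds hq)
    have hd : DifferentiableAt ℝ (fderiv ℝ g) q :=
      (hf.fderiv_right (m := ∞) (by simp)).differentiableAt (by simp)
    have key : ∀ v w : E, dirDeriv v (dirDeriv w g) q = fderiv ℝ (fderiv ℝ g) q v w := by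
      intro v w
      have h := fderiv_clm_apply hd (differentiableAt_const w)
      change fderiv ℝ (fun y => fderiv ℝ g y w) q v = _
      rw [h]
      simp
    rw [key, key]
    exact fderiv_fderiv_symm hf _ _

lemma contDiffOn_dirDeriv_iterate (hO : IsOpen O) (hg : ContDiffOn ℝ ∞ g O) (v : E) (k : ℕ) :
    ContDiffOn ℝ ∞ ((dirDeriv v)^[k] g) O :=
  (commutingOn_dirDeriv hO ![v]).good_iterate 0 k hg

lemma dirDeriv_iterate_comm (hO : IsOpen O) (hg : ContDiffOn ℝ ∞ g O) (v w : E) (k : ℕ) :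
    EqOn ((dirDeriv w)^[k] (dirDeriv v g)) (dirDeriv v ((dirDeriv w)^[k] g)) O :=
  (commutingOn_dirDeriv hO ![v, w]).iterate_op 0 1 k hg

lemma eventually_mem_of_continuous {A B : Type*} [TopologicalSpace A] [TopologicalSpace B]
    {O : Set B} (hO : IsOpen O) {c : A → B} (hc : Continuous c) {t : A} (ht : c t ∈ O) :
    ∀ᶠ s in 𝓝 t, c s ∈ O := hc.continuousAt.eventually_mem (hO.mem_nhds ht)

end

section

variable {E : Type} [NormedAddCommGroup E] [NormedSpace ℝ E] {O : Set (E × ℝ)} {g : E × ℝ → ℝ}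

/-- The direction of the parameter `ε`. -/
abbrev epsDir (E : Type) [NormedAddCommGroup E] : E × ℝ := (0, 1)

lemma iteratedDeriv_slice (hO : IsOpen O) (hg : ContDiffOn ℝ ∞ g O) (k : ℕ) :
    ∀ q ∈ O, iteratedDeriv k (fun ε => g (q.1, ε)) q.2 = ((dirDeriv (epsDir E))^[k] g) q := by
  induction k with
  | zero => intro q _; simp
  | succ k ih =>
    intro q hq
    rw [iteratedDeriv_succ, Function.iterate_succ_apply']
    have hev : ∀ᶠ ε in 𝓝 q.2, (q.1, ε) ∈ O :=
      eventually_mem_of_continuous hO (c := fun ε => (q.1, ε)) (by fun_prop) hq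
    have h1 : iteratedDeriv k (fun ε => g (q.1, ε)) =ᶠ[𝓝 q.2]
        fun ε => ((dirDeriv (epsDir E))^[k] g) (q.1, ε) := by
      filter_upwards [hev] with ε hε using ih _ hε
    rw [h1.deriv_eq]
    have hd : DifferentiableAt ℝ ((dirDeriv (epsDir E))^[k] g) (q.1, q.2) :=
      ((contDiffOn_dirDeriv_iterate hO hg _ k).contDiffAt (hO.mem_nhds hq)).differentiableAt
        (by simp)
    have hc : HasDerivAt (fun ε : ℝ => (q.1, ε)) (epsDir E) q.2 :=
      (hasDerivAt_const _ _).prodMk (hasDerivAt_id _)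
    exact (hd.hasFDerivAt.comp_hasDerivAt q.2 hc).deriv

end

/-- The derivative with respect to `t` at `0` of a Taylor coefficient in `ε` of `g(t, ε)` is the
Taylor coefficient of the derivative. -/
lemma deriv_iteratedDeriv_comm {O : Set (ℝ × ℝ)} (hO : IsOpen O) (h0 : (0, 0) ∈ O)
    {g : ℝ × ℝ → ℝ} (hg : ContDiffOn ℝ ∞ g O) (k : ℕ) :
    deriv (fun t => iteratedDeriv k (fun ε => g (t, ε)) 0) 0
      = iteratedDeriv k (fun ε => deriv (fun t => g (t, ε)) 0) 0 := by
  have hslice : ∀ g : ℝ × ℝ → ℝ, ∀ q : ℝ × ℝ, DifferentiableAt ℝ g q →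
      deriv (fun t => g (t, q.2)) q.1 = dirDeriv ((1, 0) : ℝ × ℝ) g q := by
    intro g q hd
    have hc : HasDerivAt (fun t : ℝ => (t, q.2)) ((1, 0) : ℝ × ℝ) q.1 :=
      (hasDerivAt_id _).prodMk (hasDerivAt_const _ _)
    exact (HasFDerivAt.comp_hasDerivAt (l := g) q.1 hd.hasFDerivAt hc).deriv
  have hdiff : ∀ g : ℝ × ℝ → ℝ, ContDiffOn ℝ ∞ g O → ∀ q ∈ O, DifferentiableAt ℝ g q :=
    fun g hg q hq => (hg.contDiffAt (hO.mem_nhds hq)).differentiableAt (by simp)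
  have h1 : (fun t => iteratedDeriv k (fun ε => g (t, ε)) 0) =ᶠ[𝓝 0]
      fun t => ((dirDeriv (epsDir ℝ))^[k] g) (t, 0) := by
    filter_upwards [eventually_mem_of_continuous hO (c := fun t : ℝ => (t, (0 : ℝ)))
      (by fun_prop) h0] with t ht using iteratedDeriv_slice hO hg k _ ht
  have h2 : (fun ε => deriv (fun t => g (t, ε)) 0) =ᶠ[𝓝 0]
      fun ε => dirDeriv ((1, 0) : ℝ × ℝ) g (0, ε) := by
    filter_upwards [eventually_mem_of_continuous hO (c := fun ε : ℝ => ((0 : ℝ), ε))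
      (by fun_prop) h0] with ε hε using hslice g (0, ε) (hdiff g hg _ hε)
  have hg' : ContDiffOn ℝ ∞ (dirDeriv ((1, 0) : ℝ × ℝ) g) O :=
    contDiffOn_dirDeriv_iterate hO hg _ 1
  rw [h1.deriv_eq, h2.iteratedDeriv_eq, iteratedDeriv_slice hO hg' k _ h0,
    dirDeriv_iterate_comm hO hg _ _ k h0]
  exact hslice _ (0, 0) (hdiff _ (contDiffOn_dirDeriv_iterate hO hg _ k) _ h0)

/-- If the derivatives `∂ʲR/∂εʲ(a, 0)` vanish for `j ≤ k`, then so does the `k`-th derivative of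
`R(ε, ε)` at `0`: the derivative of `R(ε, ε)` is the value at `(ε, ε)` of `(∂_a + ∂_ε) R`, which
satisfies the same hypothesis with `k - 1` in place of `k`. -/
lemma iteratedDeriv_diag_eq_zero {O : Set (ℝ × ℝ)} (hO : IsOpen O) (h0 : (0, 0) ∈ O) (k : ℕ)
    {R : ℝ × ℝ → ℝ} (hR : ContDiffOn ℝ ∞ R O)
    (hv : ∀ j ≤ k, ∀ a, (a, 0) ∈ O → ((dirDeriv (epsDir ℝ))^[j] R) (a, 0) = 0) :
    iteratedDeriv k (fun ε => R (ε, ε)) 0 = 0 := by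
  induction k generalizing R with
  | zero => simpa using hv 0 le_rfl 0 h0
  | succ k ih =>
    have hdiff : ∀ g : ℝ × ℝ → ℝ, ContDiffOn ℝ ∞ g O → ∀ q ∈ O, DifferentiableAt ℝ g q :=
      fun g hg q hq => (hg.contDiffAt (hO.mem_nhds hq)).differentiableAt (by simp)
    rw [iteratedDeriv_succ']
    have h1 : deriv (fun ε => R (ε, ε)) =ᶠ[𝓝 0]
        fun ε => dirDeriv ((1, 1) : ℝ × ℝ) R (ε, ε) := by
      filter_upwards [eventually_mem_of_continuous hO (c := fun ε : ℝ => (ε, ε))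
        (by fun_prop) h0] with ε hε
      have hc : HasDerivAt (fun t : ℝ => (t, t)) ((1, 1) : ℝ × ℝ) ε :=
        (hasDerivAt_id _).prodMk (hasDerivAt_id _)
      exact (HasFDerivAt.comp_hasDerivAt (l := R) (f := fun t : ℝ => (t, t)) ε
        (hdiff R hR (ε, ε) hε).hasFDerivAt hc).deriv
    rw [h1.iteratedDeriv_eq]
    refine ih (contDiffOn_dirDeriv_iterate hO hR _ 1) fun j hj a ha => ?_
    rw [dirDeriv_iterate_comm hO hR _ _ j ha]
    have hd := hdiff _ (contDiffOn_dirDeriv_iterate hO hR (epsDir ℝ) j) _ ha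
    have hsplit : ((1, 1) : ℝ × ℝ) = (1, 0) + epsDir ℝ := by simp
    have h2 : dirDeriv (epsDir ℝ) ((dirDeriv (epsDir ℝ))^[j] R) (a, 0) = 0 := by
      have := hv (j + 1) (by omega) a ha
      rwa [Function.iterate_succ_apply'] at this
    have h3 : fderiv ℝ ((dirDeriv (epsDir ℝ))^[j] R) (a, 0) (1, 0) = 0 := by
      have hc : HasDerivAt (fun t : ℝ => (t, (0 : ℝ))) ((1, 0) : ℝ × ℝ) a :=
        (hasDerivAt_id _).prodMk (hasDerivAt_const _ _)
      have h4 := HasFDerivAt.comp_hasDerivAt (l := (dirDeriv (epsDir ℝ))^[j] R) a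
        hd.hasFDerivAt hc
      have h5 : ((dirDeriv (epsDir ℝ))^[j] R) ∘ (fun t : ℝ => (t, (0 : ℝ))) =ᶠ[𝓝 a]
          fun _ => (0 : ℝ) := by
        filter_upwards [eventually_mem_of_continuous hO (c := fun t : ℝ => (t, (0 : ℝ)))
          (by fun_prop) ha] with t ht using hv j (by omega) t ht
      exact h4.unique ((hasDerivAt_const a (0 : ℝ)).congr_of_eventuallyEq h5)
    simp only [dirDeriv] at h2 ⊢
    rw [hsplit, map_add, h3, zero_add]
    exact h2

lemma iteratedDeriv_pow_div_factorial (k l : ℕ) :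
    iteratedDeriv k (fun ε : ℝ => ε ^ l / (l ! : ℝ)) 0 = if k = l then 1 else 0 := by
  rw [iteratedDeriv_eq_iterate, ← deriv_iterate_taylorMonomial 0 l k]
  have : (fun ε : ℝ => ε ^ l / (l ! : ℝ)) = taylorMonomial 0 l := by
    funext t
    simp [taylorMonomial]
  rw [this]

/-- Replacing `G(a, ·)` by its Taylor polynomial of degree `p` does not change the derivatives of
order at most `p` of `G(ε, ε)` at `0`. -/
lemma iteratedDeriv_diag_taylor {O : Set (ℝ × ℝ)} (hO : IsOpen O) (h0 : (0, 0) ∈ O)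
    {G : ℝ × ℝ → ℝ} (hG : ContDiffOn ℝ ∞ G O) {p k : ℕ} (hk : k ≤ p) :
    iteratedDeriv k (fun ε => ∑ l ∈ Finset.range (p + 1),
        ε ^ l * (iteratedDeriv l (fun η => G (ε, η)) 0 / (l ! : ℝ))) 0
      = iteratedDeriv k (fun ε => G (ε, ε)) 0 := by
  -- the Taylor polynomial uses the values of the derivatives at `(a, 0)`
  set O₁ : Set (ℝ × ℝ) := O ∩ (fun q => (q.1, (0 : ℝ))) ⁻¹' O with hO₁
  have hO₁o : IsOpen O₁ := hO.inter (hO.preimage (by fun_prop))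
  have h0₁ : ((0, 0) : ℝ × ℝ) ∈ O₁ := ⟨h0, h0⟩
  set T : ℝ × ℝ → ℝ := fun q => ∑ l ∈ Finset.range (p + 1),
    q.2 ^ l / (l ! : ℝ) * ((dirDeriv (epsDir ℝ))^[l] G) (q.1, 0) with hT
  have hTs : ContDiffOn ℝ ∞ T O₁ := by
    refine ContDiffOn.sum fun l _ => ContDiffOn.mul (by fun_prop) ?_
    exact (contDiffOn_dirDeriv_iterate hO hG _ l).comp (by fun_prop) fun q hq => hq.2
  have hGs : ContDiffOn ℝ ∞ G O₁ := hG.mono inter_subset_left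
  have hRs : ContDiffOn ℝ ∞ (fun q => G q - T q) O₁ := hGs.sub hTs
  have hR0 : ∀ j ≤ k, ∀ a, (a, 0) ∈ O₁ →
      ((dirDeriv (epsDir ℝ))^[j] (fun q => G q - T q)) (a, 0) = 0 := by
    intro j hj a ha
    rw [← iteratedDeriv_slice hO₁o hRs j _ ha]
    have hsl : ContDiffAt ℝ j (fun η => G (a, η)) 0 :=
      ContDiffAt.comp (g := G) (f := fun η : ℝ => (a, η)) (0 : ℝ)
        ((hG.contDiffAt (hO.mem_nhds ha.1)).of_le (by exact_mod_cast le_top)) (by fun_prop)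
    have hterm : ∀ l ∈ Finset.range (p + 1), ContDiffAt ℝ j (fun η : ℝ =>
        η ^ l / (l ! : ℝ) * ((dirDeriv (epsDir ℝ))^[l] G) (a, 0)) 0 := fun l _ => by fun_prop
    rw [iteratedDeriv_fun_sub hsl (ContDiffAt.sum hterm), iteratedDeriv_fun_sum hterm]
    have h1 : ∀ l, iteratedDeriv j (fun η : ℝ =>
        η ^ l / (l ! : ℝ) * ((dirDeriv (epsDir ℝ))^[l] G) (a, 0)) 0
        = if j = l then ((dirDeriv (epsDir ℝ))^[l] G) (a, 0) else 0 := by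
      intro l
      rw [iteratedDeriv_mul_const_field, iteratedDeriv_pow_div_factorial]
      simp
    rw [Finset.sum_congr rfl fun l _ => h1 l, Finset.sum_ite_eq,
      if_pos (Finset.mem_range.2 (by omega)), iteratedDeriv_slice hO hG j (a, 0) ha.1, sub_self]
  have hdiag := iteratedDeriv_diag_eq_zero hO₁o h0₁ k hRs hR0
  have hcomp : ∀ g : ℝ × ℝ → ℝ, ContDiffOn ℝ ∞ g O₁ → ContDiffAt ℝ k (fun ε => g (ε, ε)) 0 :=
    fun g hg => ContDiffAt.comp (g := g) (f := fun ε : ℝ => (ε, ε)) (0 : ℝ)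
      ((hg.contDiffAt (hO₁o.mem_nhds h0₁)).of_le (by exact_mod_cast le_top)) (by fun_prop)
  rw [iteratedDeriv_fun_sub (hcomp G hGs) (hcomp T hTs), sub_eq_zero] at hdiag
  rw [hdiag]
  refine Filter.EventuallyEq.iteratedDeriv_eq k ?_
  filter_upwards [eventually_mem_of_continuous hO (c := fun t : ℝ => (t, (0 : ℝ)))
    (by fun_prop) h0] with ε hε
  simp only [hT]
  refine Finset.sum_congr rfl fun l _ => ?_
  rw [iteratedDeriv_slice hO hG l (ε, 0) hε]
  ring

end

section

variable {n m p r s : ℕ}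

/-! ### Expansion coefficients as functions on jets -/

/-- `perturbedJet` on jets of finite order, together with the parameter. -/
def finPerturbedJet (r : ℕ) (q : FinJet n m p r × ℝ) : Jet n m r × ℝ :=
  ((q.1.1, fun α J => ∑ k : Fin (p + 1), q.2 ^ (k : ℕ) * q.1.2 (k, α, J)), q.2)

lemma finPerturbedJet_restr (z : ExpJet n m p) (ε : ℝ) :
    finPerturbedJet r (restr r z, ε) = (perturbedJet r z ε, ε) := rfl

lemma contDiff_finPerturbedJet : ContDiff ℝ ∞ (finPerturbedJet (n := n) (m := m) (p := p) r) := by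
  unfold finPerturbedJet
  refine ContDiff.prodMk (ContDiff.prodMk (by fun_prop) ?_) (by fun_prop)
  exact contDiff_pi' fun α => contDiff_pi' fun J => ContDiff.sum fun k _ => by fun_prop

@[simp] lemma perturbedJet_zero (z : ExpJet n m p) : perturbedJet r z 0 = baseJet r z := by
  simp [perturbedJet, baseJet, Fin.sum_univ_succ]

lemma isJetFunOn_expCoeff {W : Set (Jet n m r)} {f : Jet n m r × ℝ → ℝ} (hf : SmoothNearZero W f)
    (p k : ℕ) : IsJetFunOn (jetsOver p W) r (expCoeff p f k) := by
  obtain ⟨O, hO, hWO, hf⟩ := hf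
  have hO' : IsOpen (finPerturbedJet (n := n) (m := m) (p := p) r ⁻¹' O) :=
    hO.preimage contDiff_finPerturbedJet.continuous
  have hg : ContDiffOn ℝ ∞ (f ∘ finPerturbedJet (n := n) (m := m) (p := p) r)
      (finPerturbedJet r ⁻¹' O) := hf.comp contDiff_finPerturbedJet.contDiffOn fun _ h => h
  have hmem : ∀ z ∈ jetsOver p W, (restr r z, (0 : ℝ)) ∈ finPerturbedJet r ⁻¹' O := by
    intro z hz
    rw [mem_preimage, finPerturbedJet_restr, perturbedJet_zero]
    exact hWO _ hz
  refine ⟨fun y => ((dirDeriv (epsDir _))^[k] (f ∘ finPerturbedJet r)) (y, 0) / (k ! : ℝ),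
    fun z hz => ?_, fun z hz => ?_⟩
  · refine ContDiffAt.div_const ?_ _
    exact ContDiffAt.comp (f := fun y => (y, (0 : ℝ))) (restr r z)
      ((contDiffOn_dirDeriv_iterate hO' hg _ k).contDiffAt (hO'.mem_nhds (hmem z hz)))
      (by fun_prop)
  · simp only [expCoeff, Function.comp]
    congr 1
    exact iteratedDeriv_slice hO' hg k _ (hmem z hz)

lemma contDiffAt_comp_perturbedJet {W : Set (Jet n m r)} {f : Jet n m r × ℝ → ℝ}
    (hf : SmoothNearZero W f) {z : ExpJet n m p} (hz : z ∈ jetsOver p W) :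
    ContDiffAt ℝ ∞ (fun ε : ℝ => f (perturbedJet r z ε, ε)) 0 := by
  obtain ⟨O, hO, hWO, hf⟩ := hf
  have h1 : ContDiffAt ℝ ∞ f (finPerturbedJet r (restr r z, 0)) := by
    rw [finPerturbedJet_restr, perturbedJet_zero]
    exact hf.contDiffAt (hO.mem_nhds (hWO _ hz))
  exact ContDiffAt.comp (g := f) (f := fun ε : ℝ => finPerturbedJet r (restr r z, ε)) (0 : ℝ) h1
    (contDiff_finPerturbedJet.contDiffAt.comp (0 : ℝ) (by fun_prop))

lemma SmoothNearZero.mono {W W' : Set (Jet n m r)} (h : W' ⊆ W) {f : Jet n m r × ℝ → ℝ}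
    (hf : SmoothNearZero W f) : SmoothNearZero W' f := by
  obtain ⟨O, hO, hWO, hf⟩ := hf
  exact ⟨O, hO, fun z hz => hWO z (h hz), hf⟩

/-- The sum `∑_ν Λ^ν Δ^ν`, which plays the part of a Lagrangian. -/
def multiplierSum {q : ℕ} (Δ Λ : Fin q → Jet n m r × ℝ → ℝ) : Jet n m r × ℝ → ℝ :=
  fun y => ∑ ν, Λ ν y * Δ ν y

lemma smoothNearZero_multiplierSum {q : ℕ} {W : Set (Jet n m r)}
    {Δ Λ : Fin q → Jet n m r × ℝ → ℝ} (hΔ : ∀ ν, SmoothNearZero W (Δ ν))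
    (hΛ : ∀ ν, SmoothNearZero W (Λ ν)) : SmoothNearZero W (multiplierSum Δ Λ) := by
  choose O hO hWO hs using hΔ
  choose O' hO' hWO' hs' using hΛ
  refine ⟨⋂ ν, (O ν ∩ O' ν), isOpen_iInter_of_finite fun ν => (hO ν).inter (hO' ν),
    fun z hz => mem_iInter.2 fun ν => ⟨hWO ν z hz, hWO' ν z hz⟩, ?_⟩
  refine ContDiffOn.sum fun ν _ => ContDiffOn.mul ?_ ?_
  · exact (hs' ν).mono fun y hy => (mem_iInter.1 hy ν).2
  · exact (hs ν).mono fun y hy => (mem_iInter.1 hy ν).1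

/-- Leibniz rule: the products of the coefficients are the coefficients of the product. -/
lemma combCoeff_eq_expCoeff {q : ℕ} {W : Set (Jet n m r)} {Δ Λ : Fin q → Jet n m r × ℝ → ℝ}
    (hΔ : ∀ ν, SmoothNearZero W (Δ ν)) (hΛ : ∀ ν, SmoothNearZero W (Λ ν)) (p k : ℕ) :
    EqOn (combCoeff p Δ Λ k) (expCoeff p (multiplierSum Δ Λ) k) (jetsOver p W) := by
  intro z hz
  have hd : ∀ (j : ℕ) ν, ContDiffAt ℝ j (fun ε : ℝ => Δ ν (perturbedJet r z ε, ε)) 0 :=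
    fun j ν => (contDiffAt_comp_perturbedJet (hΔ ν) hz).of_le (by exact_mod_cast le_top)
  have hl : ∀ (j : ℕ) ν, ContDiffAt ℝ j (fun ε : ℝ => Λ ν (perturbedJet r z ε, ε)) 0 :=
    fun j ν => (contDiffAt_comp_perturbedJet (hΛ ν) hz).of_le (by exact_mod_cast le_top)
  simp only [combCoeff, expCoeff, multiplierSum]
  rw [iteratedDeriv_fun_sum fun ν _ => (hl k ν).mul (hd k ν), Finset.sum_comm, Finset.sum_div]
  refine Finset.sum_congr rfl fun ν _ => ?_
  rw [iteratedDeriv_fun_mul (hl k ν) (hd k ν), Finset.sum_div]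
  refine Finset.sum_congr rfl fun l hlk => ?_
  have hlk : l ≤ k := by simpa [Nat.lt_succ_iff] using hlk
  rw [Nat.cast_choose ℝ hlk]
  have h1 : (k ! : ℝ) ≠ 0 := by positivity
  have h2 : (l ! : ℝ) ≠ 0 := by positivity
  have h3 : ((k - l)! : ℝ) ≠ 0 := by positivity
  field_simp

/-! ### Restriction of the Euler operator to vanishing perturbations -/

/-- The jets with `u_{(1)} = ⋯ = u_{(p)} = 0`. -/
noncomputable def zeroExtend (p : ℕ) (z : ExpJet n m 0) : ExpJet n m p :=
  (z.1, fun c => if c.1 = 0 then z.2 (0, c.2) else 0)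

lemma zeroExtend_update (z : ExpJet n m 0) (a : Fin m × (Fin n → ℕ)) (t : ℝ) :
    ((zeroExtend p z).1, Function.update (zeroExtend p z).2 (0, a) t)
      = zeroExtend p (z.1, Function.update z.2 (0, a) t) := by
  refine Prod.ext rfl ?_
  funext c
  obtain ⟨k, b⟩ := c
  by_cases hk : k = 0
  · subst hk
    by_cases hb : b = a
    · subst hb; simp [zeroExtend]
    · simp [zeroExtend, hb]
  · simp [zeroExtend, hk]

lemma partialU_comp_zeroExtend (a : Fin m × (Fin n → ℕ)) (F : ExpJet n m p → ℝ) :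
    partialU (0, a) F ∘ zeroExtend p = partialU (0, a) (F ∘ zeroExtend p) := by
  funext z
  simp only [partialU, Function.comp, zeroExtend_update]
  congr 1

lemma totalDeriv_comp_zeroExtend (i : Fin n) (F : ExpJet n m p → ℝ) :
    totalDeriv i F ∘ zeroExtend p = totalDeriv i (F ∘ zeroExtend p) := by
  funext z
  simp only [totalDeriv, Function.comp]
  congr 1
  have hinj : ∀ k : Fin (0 + 1), k = 0 := fun k => Fin.ext (by omega)
  rw [finsum_comp_of_injective (fun c : Coord n m 0 => ((0, c.2) : Coord n m p))]
  · refine finsum_congr fun c => ?_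
    obtain ⟨k, a⟩ := c
    obtain rfl := hinj k
    rw [← Function.comp_apply (f := partialU ((0, a) : Coord n m p) F),
      partialU_comp_zeroExtend]
    simp [zeroExtend, Coord.shift, Function.comp_def]
  · rintro ⟨k, a⟩ ⟨k', a'⟩ h
    simp only [Prod.mk.injEq, true_and] at h
    rw [h, hinj k, hinj k']
  · rintro ⟨k, a⟩ hc
    have hk : k ≠ 0 := by
      rintro rfl
      exact hc ⟨(0, a), rfl⟩
    simp [zeroExtend, Coord.shift, hk]

lemma approxEuler_comp_zeroExtend (r : ℕ) (α : Fin m) (F : ExpJet n m p → ℝ) (z : ExpJet n m 0) :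
    approxEuler r α F (zeroExtend p z) = approxEuler r α (F ∘ zeroExtend p) z := by
  simp only [approxEuler]
  refine Finset.sum_congr rfl fun J _ => ?_
  have h := iterMulti_map (op := totalDeriv) (op' := totalDeriv)
    (fun F : ExpJet n m p → ℝ => F ∘ zeroExtend p) (fun i b => totalDeriv_comp_zeroExtend i b) J.1
    (partialU (0, α, J.1) F)
  simp only [partialU_comp_zeroExtend] at h
  rw [← h]
  rfl

lemma perturbedJet_zeroExtend (z : ExpJet n m 0) (ε : ℝ) :
    perturbedJet r (zeroExtend p z) ε = perturbedJet r z ε := by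
  refine Prod.ext rfl ?_
  funext α J
  simp [perturbedJet, zeroExtend]

lemma expCoeff_comp_zeroExtend (f : Jet n m r × ℝ → ℝ) (k : ℕ) :
    expCoeff p f k ∘ zeroExtend p = expCoeff 0 f k := by
  funext z
  simp only [expCoeff, Function.comp, perturbedJet_zeroExtend]

/-! ### The expansion of a divergence -/

/-- The jet of `∑ₖ εᵏ u_{(k)}`, as a jet of a single map. -/
def sumJet (ε : ℝ) (z : ExpJet n m p) : ExpJet n m 0 :=
  (z.1, fun c => ∑ k : Fin (p + 1), ε ^ (k : ℕ) * z.2 (k, c.2))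

lemma perturbedJet_sumJet (ε η : ℝ) (z : ExpJet n m p) :
    perturbedJet r (sumJet ε z) η = perturbedJet r z ε := by
  refine Prod.ext rfl ?_
  funext α J
  simp [perturbedJet, sumJet]

lemma sumJet_line (ε t : ℝ) (z : ExpJet n m p) (i : Fin n) :
    sumJet ε (z + t • totalVec i z) = sumJet ε z + t • totalVec i (sumJet ε z) := by
  refine Prod.ext rfl ?_
  funext c
  simp only [sumJet, totalVec, Prod.snd_add, Prod.smul_snd, Pi.add_apply, Pi.smul_apply,
    smul_eq_mul, Finset.mul_sum, ← Finset.sum_add_distrib]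
  exact Finset.sum_congr rfl fun k _ => by simp only [Coord.shift]; ring

lemma eventually_sumJet_mem {W : Set (Jet n m r)} (hW : IsOpen W) {z : ExpJet n m p}
    (hz : z ∈ jetsOver p W) : ∀ᶠ ε : ℝ in 𝓝 0, sumJet ε z ∈ jetsOver 0 W := by
  refine eventually_mem_of_continuous hW (c := fun ε => perturbedJet r z ε) ?_ ?_
  · unfold perturbedJet
    fun_prop
  · rw [perturbedJet_zero]; exact hz

lemma contDiffAt_comp_sumJet {W : Set (Jet n m r)} (hW : IsOpen W) {N : ℕ}
    {H : ExpJet n m 0 → ℝ} (hH : IsJetFunOn (jetsOver 0 W) N H) {z : ExpJet n m p}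
    (hz : z ∈ jetsOver p W) : ContDiffAt ℝ ∞ (fun ε => H (sumJet ε z)) 0 := by
  obtain ⟨h, hh, hH⟩ := hH
  have hev := eventually_sumJet_mem hW hz
  have h1 : ContDiffAt ℝ ∞ (fun ε => h (restr N (sumJet ε z))) 0 := by
    refine ContDiffAt.comp (g := h) (f := fun ε : ℝ => restr N (sumJet ε z)) (0 : ℝ)
      (hh _ hev.self_of_nhds) (ContDiffAt.prodMk (by fun_prop) (contDiffAt_pi.2 fun c => ?_))
    change ContDiffAt ℝ ∞ (fun ε : ℝ => ∑ k : Fin (p + 1), ε ^ (k : ℕ) * z.2 (k, c.toCoord.2)) 0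
    fun_prop
  refine h1.congr_of_eventuallyEq ?_
  filter_upwards [hev] with ε hε using hH hε

/-- A jet of order `s` of a single map, as a finite-order jet of coefficients. -/
def jetToFinJet (s : ℕ) (y : Jet n m s) : FinJet n m 0 s := (y.1, fun c => y.2 c.2.1 c.2.2)

lemma jetToFinJet_perturbedJet (z : ExpJet n m p) (ε : ℝ) :
    jetToFinJet s (perturbedJet s z ε) = restr s (sumJet ε z) := rfl

lemma exists_restr_eq_jetToFinJet (y : Jet n m s) :
    ∃ z : ExpJet n m 0, baseJet s z = y ∧ restr s z = jetToFinJet s y := by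
  refine ⟨(y.1, fun c => if h : ∑ i, c.2.2 i ≤ s then y.2 c.2.1 ⟨c.2.2, h⟩ else 0),
    Prod.ext rfl ?_, Prod.ext rfl ?_⟩
  · funext α J
    exact dif_pos J.2
  · funext c
    exact dif_pos c.2.2.2

/-- The fluxes `∑ₗ εˡ Pₗ`. -/
def powerFlux (p s : ℕ) (f : ℕ → Fin n → FinJet n m 0 s → ℝ) (i : Fin n) (y : Jet n m s × ℝ) : ℝ :=
  ∑ l ∈ Finset.range (p + 1), y.2 ^ l * f l i (jetToFinJet s y.1)

section

variable {W : Set (Jet n m r)} {f : ℕ → Fin n → FinJet n m 0 s → ℝ}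

lemma smoothNearZero_powerFlux (hW : IsOpen W) (hrs : r ≤ s)
    (hf : ∀ l ∈ Finset.range (p + 1), ∀ i, ∀ z ∈ jetsOver 0 W, ContDiffAt ℝ ∞ (f l i) (restr s z))
    (i : Fin n) : SmoothNearZero (Jet.trunc hrs ⁻¹' W) (powerFlux p s f i) := by
  have hto : ContDiff ℝ ∞ (jetToFinJet (n := n) (m := m) s) := by
    unfold jetToFinJet
    fun_prop
  have htr : Continuous (Jet.trunc (n := n) (m := m) hrs) := by
    unfold Jet.trunc
    fun_prop
  refine ⟨(Jet.trunc hrs ⁻¹' W) ×ˢ univ, (hW.preimage htr).prod isOpen_univ,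
    fun z hz => ⟨hz, mem_univ _⟩, ContDiffOn.sum fun l hl => ?_⟩
  intro y hy
  refine ContDiffAt.contDiffWithinAt (ContDiffAt.mul (by fun_prop) ?_)
  obtain ⟨z, hz, hzy⟩ := exists_restr_eq_jetToFinJet y.1
  have hmem : z ∈ jetsOver 0 W := by
    have : Jet.trunc hrs (baseJet s z) ∈ W := by rw [hz]; exact hy.1
    exact this
  refine ContDiffAt.comp (g := f l i) (f := fun y : Jet n m s × ℝ => jetToFinJet s y.1) y ?_
    (hto.contDiffAt.comp y contDiffAt_fst)
  rw [← hzy]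
  exact hf l hl i z hmem

/-- Total derivatives commute with the extraction of coefficients: the coefficients of a divergence
are those of `∑ₗ εˡ ∑ᵢ Dᵢ Pₗⁱ`, evaluated at the jet of `∑ₖ εᵏ u_{(k)}`. -/
lemma divCoeff_powerFlux (hW : IsOpen W) (hrs : r ≤ s)
    (hf : ∀ l ∈ Finset.range (p + 1), ∀ i, ∀ z ∈ jetsOver 0 W, ContDiffAt ℝ ∞ (f l i) (restr s z))
    {H : ℕ → ExpJet n m 0 → ℝ}
    (hH : ∀ l ∈ Finset.range (p + 1),
      EqOn (H l) (fun z => ∑ i, totalDeriv i (f l i ∘ restr s) z) (jetsOver 0 W))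
    {z : ExpJet n m p} (hz : z ∈ jetsOver p W) (k : ℕ) :
    divCoeff p (powerFlux p s f) k z
      = iteratedDeriv k (fun ε => ∑ l ∈ Finset.range (p + 1), ε ^ l * H l (sumJet ε z)) 0
        / (k ! : ℝ) := by
  have hU : IsOpen (jetsOver p W) := isOpen_jetsOver hW
  have hU0 : IsOpen (jetsOver 0 W) := isOpen_jetsOver hW
  have hev := eventually_sumJet_mem hW hz
  have hjet : ∀ l ∈ Finset.range (p + 1), ∀ i, IsJetFunOn (jetsOver 0 W) s (f l i ∘ restr s) :=
    fun l hl i => ⟨f l i, hf l hl i, fun _ _ => rfl⟩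
  have hΦ := smoothNearZero_powerFlux hW hrs hf
  have hone : ∀ i, totalDeriv i (expCoeff p (powerFlux p s f i) k) z
      = iteratedDeriv k (fun ε => ∑ l ∈ Finset.range (p + 1),
          ε ^ l * totalDeriv i (f l i ∘ restr s) (sumJet ε z)) 0 / (k ! : ℝ) := by
    intro i
    have hE : IsJetFunOn (jetsOver p W) s (expCoeff p (powerFlux p s f i) k) :=
      isJetFunOn_expCoeff (hΦ i) p k
    rw [totalDeriv_eq_lineDeriv hU hE i hz]
    obtain ⟨O, hO, hWO, hs⟩ := hΦ i
    set c : ℝ × ℝ → Jet n m s × ℝ :=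
      fun q => finPerturbedJet s (restr s z + q.1 • restr s (totalVec i z), q.2) with hc
    have hcs : ContDiff ℝ ∞ c := contDiff_finPerturbedJet.comp (by fun_prop)
    have hcz : ∀ t ε, c (t, ε) = (perturbedJet s (z + t • totalVec i z) ε, ε) := by
      intro t ε
      rw [← finPerturbedJet_restr, map_add, map_smul]
    have h0 : ((0, 0) : ℝ × ℝ) ∈ c ⁻¹' O := by
      rw [mem_preimage, hcz, zero_smul, add_zero, perturbedJet_zero]
      exact hWO _ hz
    have hcomm := deriv_iteratedDeriv_comm (hO.preimage hcs.continuous) h0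
      (hs.comp hcs.contDiffOn fun _ h => h) k
    simp only [lineDeriv, expCoeff]
    rw [deriv_div_const]
    congr 1
    simp only [Function.comp, hcz] at hcomm
    rw [hcomm]
    refine Filter.EventuallyEq.iteratedDeriv_eq k ?_
    filter_upwards [hev] with ε hε
    simp only [powerFlux, jetToFinJet_perturbedJet, sumJet_line]
    refine HasDerivAt.deriv (HasDerivAt.fun_sum fun l hl => HasDerivAt.const_mul _ ?_)
    rw [totalDeriv_eq_lineDeriv hU0 (hjet l hl i) i hε]
    exact ((hjet l hl i).lineDifferentiableAt hU0 hε _).hasLineDerivAt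
  simp only [divCoeff, hone]
  rw [← Finset.sum_div, ← iteratedDeriv_fun_sum fun i _ => ?_]
  · congr 1
    refine Filter.EventuallyEq.iteratedDeriv_eq k ?_
    filter_upwards [hev] with ε hε
    rw [Finset.sum_comm]
    exact Finset.sum_congr rfl fun l hl => by rw [hH l hl hε, Finset.mul_sum]
  · refine ContDiffAt.sum fun l hl => ContDiffAt.mul (by fun_prop) ?_
    exact (contDiffAt_comp_sumJet hW ((hjet l hl i).totalDeriv hU0 i) hz).of_le
      (by exact_mod_cast le_top)

end

/-- If the coefficients `L_l = ∂ˡL/∂εˡ / l!` at `ε = 0` are the total divergences of `P_l`, then the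
flux `∑ₗ εˡ Pₗ` has the divergence `L` up to terms of order `p + 1`. -/
lemma divCoeff_powerFlux_eq_expCoeff {W : Set (Jet n m r)} (hW : IsOpen W) (hrs : r ≤ s)
    {f : ℕ → Fin n → FinJet n m 0 s → ℝ}
    (hf : ∀ l ∈ Finset.range (p + 1), ∀ i, ∀ z ∈ jetsOver 0 W, ContDiffAt ℝ ∞ (f l i) (restr s z))
    {L : Jet n m r × ℝ → ℝ} (hL : SmoothNearZero W L)
    (hH : ∀ l ∈ Finset.range (p + 1),
      EqOn (expCoeff 0 L l) (fun z => ∑ i, totalDeriv i (f l i ∘ restr s) z) (jetsOver 0 W))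
    {k : ℕ} (hk : k ∈ Finset.range (p + 1)) :
    EqOn (divCoeff p (powerFlux p s f) k) (expCoeff p L k) (jetsOver p W) := by
  intro z hz
  rw [divCoeff_powerFlux hW hrs hf hH hz]
  obtain ⟨O, hO, hWO, hL⟩ := hL
  set c : ℝ × ℝ → Jet n m r × ℝ :=
    fun q => ((finPerturbedJet r (restr r z, q.1)).1, q.2) with hc
  have hcs : ContDiff ℝ ∞ c :=
    (contDiff_fst.comp (contDiff_finPerturbedJet.comp (by fun_prop))).prodMk (by fun_prop)
  have h0 : ((0, 0) : ℝ × ℝ) ∈ c ⁻¹' O := by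
    simp only [mem_preimage, hc, finPerturbedJet_restr, perturbedJet_zero]
    exact hWO _ hz
  have h := iteratedDeriv_diag_taylor (hO.preimage hcs.continuous) h0
    (hL.comp hcs.contDiffOn fun _ h => h) (p := p) (k := k) (by simpa [Nat.lt_succ_iff] using hk)
  simp only [expCoeff, perturbedJet_sumJet]
  congr 1

end

section

variable {n m q p r : ℕ} {D W : Set (Jet n m r)} {Δ Λ : Fin q → Jet n m r × ℝ → ℝ}

/-! ### The Euler condition in terms of coefficients -/

lemma isJetFunOn_combCoeff (hΔ : ∀ ν, SmoothNearZero W (Δ ν)) (hΛ : ∀ ν, SmoothNearZero W (Λ ν))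
    (p k : ℕ) : IsJetFunOn (jetsOver p W) r (combCoeff p Δ Λ k) :=
  (isJetFunOn_expCoeff (smoothNearZero_multiplierSum hΔ hΛ) p k).congr
    (combCoeff_eq_expCoeff hΔ hΛ p k)

lemma eulerCondition_iff (hW : IsOpen W) (hΔ : ∀ ν, SmoothNearZero W (Δ ν))
    (hΛ : ∀ ν, SmoothNearZero W (Λ ν)) :
    EulerCondition p W Δ Λ ↔ ∀ k ∈ Finset.range (p + 1), ∀ α,
      EqOn (approxEuler r α (combCoeff p Δ Λ k)) (fun _ => 0) (jetsOver p W) := by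
  have hU : IsOpen (jetsOver p W) := isOpen_jetsOver hW
  have hsum : ∀ (α : Fin m) (ε : ℝ), EqOn
      (approxEuler r α (fun z => ∑ k ∈ Finset.range (p + 1), ε ^ k * combCoeff p Δ Λ k z))
      (fun z => ∑ k ∈ Finset.range (p + 1), ε ^ k * approxEuler r α (combCoeff p Δ Λ k) z)
      (jetsOver p W) := fun α ε =>
    approxEuler_sum hU _ _ _ (fun k _ => isJetFunOn_combCoeff hΔ hΛ p k) r α
  constructor
  · intro h k hk α
    obtain ⟨N, hN⟩ := exists_isJetFunOn_approxEuler hU (isJetFunOn_combCoeff hΔ hΛ p k) r α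
    refine eqOn_of_admissible hW hN (IsJetFunOn.const 0) fun V u hu x hx => ?_
    have h1 := h α V u hu x hx
    simp only [hsum α _ (expJetOf_mem_jetsOver hu hx)] at h1
    exact (isBigO_pow_iff p _).1 h1 k hk
  · intro h α V u hu x hx
    have hz := expJetOf_mem_jetsOver hu hx
    simp only [hsum α _ hz]
    exact (isBigO_pow_iff p fun k => approxEuler r α (combCoeff p Δ Λ k) (expJetOf u x)).2
      fun k hk => h k hk α hz

/-! ### Fluxes imply the Euler condition -/

lemma approxEuler_combCoeff_eq_zero (hW : IsOpen W) (hΔ : ∀ ν, SmoothNearZero W (Δ ν))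
    (hΛ : ∀ ν, SmoothNearZero W (Λ ν)) (h : YieldsConservationLaw p D W Δ Λ) {k : ℕ}
    (hk : k ∈ Finset.range (p + 1)) (α : Fin m) :
    EqOn (approxEuler r α (combCoeff p Δ Λ k)) (fun _ => 0) (jetsOver p W) := by
  obtain ⟨s, hrs, Φ, hΦ, hdiv, -⟩ := h
  have hU : IsOpen (jetsOver p W) := isOpen_jetsOver hW
  have hE : ∀ i, IsJetFunOn (jetsOver p W) s (expCoeff p (Φ i) k) := fun i =>
    isJetFunOn_expCoeff (hΦ i) p k
  have hcomb := isJetFunOn_combCoeff hΔ hΛ p k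
  have heq : EqOn (combCoeff p Δ Λ k)
      (fun z => ∑ i, 1 * totalDeriv i (expCoeff p (Φ i) k) z) (jetsOver p W) := by
    refine eqOn_of_admissible hW (hcomb.mono (hrs.trans s.le_succ))
      (.sum fun i _ => (IsJetFunOn.const 1).mul ((hE i).totalDeriv hU i)) fun V u hu x hx => ?_
    have h1 := (isBigO_pow_iff p _).1 (hdiv V u hu x hx) k hk
    simpa [divCoeff, sub_eq_zero] using h1
  intro z hz
  rw [← approxEuler_of_le hU (hrs.trans s.le_succ) hcomb α hz, approxEuler_congr hU heq _ α hz,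
    approxEuler_sum hU _ _ _ (fun i _ => (hE i).totalDeriv hU i) _ α hz]
  refine Finset.sum_eq_zero fun i _ => ?_
  rw [approxEuler_totalDeriv hU (hE i) i α hz, mul_zero]

/-! ### Construction of fluxes -/

lemma zeroExtend_mem {z : ExpJet n m 0} (hz : z ∈ jetsOver 0 W) :
    zeroExtend p z ∈ jetsOver p W := by
  have h : baseJet r (zeroExtend p z) = baseJet r z := by
    rw [← perturbedJet_zero, perturbedJet_zeroExtend, perturbedJet_zero]
  simp only [jetsOver, mem_preimage, h]
  exact hz

lemma yieldsConservationLaw_of_starShaped (hn : 0 < n) (hW : IsOpen W)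
    (hΔ : ∀ ν, SmoothNearZero W (Δ ν)) (hΛ : ∀ ν, SmoothNearZero W (Λ ν))
    (hns : NonSingular p D W Δ) (hstar : StarShapedDomain W)
    (hE : ∀ k ∈ Finset.range (p + 1), ∀ α,
      EqOn (approxEuler r α (combCoeff p Δ Λ k)) (fun _ => 0) (jetsOver p W)) :
    YieldsConservationLaw p D W Δ Λ := by
  have hU : IsOpen (jetsOver p W) := isOpen_jetsOver hW
  have hU0 : IsOpen (jetsOver 0 W) := isOpen_jetsOver hW
  have hL := smoothNearZero_multiplierSum hΔ hΛ
  obtain ⟨x₀, u₀, hx₀, hu₀, hseg⟩ := hstar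
  have hdivergence : ∀ l ∈ Finset.range (p + 1),
      IsDivergenceOn (jetsOver 0 W) (expCoeff 0 (multiplierSum Δ Λ) l) := by
    intro l hl
    refine isDivergenceOn_of_approxEuler_eq_zero hW hu₀ hseg hn hx₀
      (isJetFunOn_expCoeff hL 0 l) fun α z hz => ?_
    have hz' := zeroExtend_mem (p := p) hz
    rw [← expCoeff_comp_zeroExtend (p := p), ← approxEuler_comp_zeroExtend,
      ← approxEuler_congr hU (combCoeff_eq_expCoeff hΔ hΛ p l) r α hz']
    exact hE l hl α hz'
  choose! N Φ hΦ hH using hdivergence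
  set s := max r ((Finset.range (p + 1)).sup N) with hs
  have hrs : r ≤ s := le_max_left _ _
  have hΦs : ∀ l ∈ Finset.range (p + 1), ∀ i, IsJetFunOn (jetsOver 0 W) s (Φ l i) :=
    fun l hl i => (hΦ l hl i).mono ((Finset.le_sup hl).trans (le_max_right _ _))
  choose! f hf hΦf using hΦs
  have hdiv : ∀ k ∈ Finset.range (p + 1),
      EqOn (divCoeff p (powerFlux p s f) k) (combCoeff p Δ Λ k) (jetsOver p W) := by
    intro k hk
    refine (divCoeff_powerFlux_eq_expCoeff hW hrs hf hL (fun l hl z hz => ?_) hk).trans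
      (combCoeff_eq_expCoeff hΔ hΛ p k).symm
    rw [hH l hl hz]
    exact Finset.sum_congr rfl fun i _ => totalDeriv_congr hU0 (hΦf l hl i) i hz
  refine ⟨s, hrs, powerFlux p s f, smoothNearZero_powerFlux hW hrs hf, fun V u hu x hx => ?_,
    fun V u hu x hx => ?_⟩
  · refine (isBigO_pow_iff p fun k => combCoeff p Δ Λ k (expJetOf u x)
      - divCoeff p (powerFlux p s f) k (expJetOf u x)).2 fun k hk => ?_
    rw [hdiv k hk (expJetOf_mem_jetsOver hu hx), sub_self]
  · refine (isBigO_pow_iff p fun k => divCoeff p (powerFlux p s f) k (expJetOf u x)).2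
      fun k hk => ?_
    have hmem : expJetOf u x ∈ jetsOver p W := hns V u hu x hx
    rw [hdiv k hk hmem]
    refine Finset.sum_eq_zero fun l _ => Finset.sum_eq_zero fun ν _ => ?_
    have hkp : k - l ∈ Finset.range (p + 1) := by
      rw [Finset.mem_range] at *
      omega
    rw [(isBigO_pow_iff p fun k => expCoeff p (Δ ν) k (expJetOf u x)).1 (hu.eq_zero ν x hx) _ hkp,
      mul_zero]

/-- Every point of an open set of jets has a neighbourhood that is star-shaped about the jets of a
polynomial. -/
lemma exists_starShaped_nhds (hW : IsOpen W) {z : Jet n m r} (hz : z ∈ W) :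
    ∃ W' : Set (Jet n m r), IsOpen W' ∧ z ∈ W' ∧ W' ⊆ W ∧ StarShapedDomain W' := by
  choose u hu hJ using fun α : Fin m => exists_contDiff_iterMulti_eq r z.1
    (fun J => if h : ∑ i, J i ≤ r then z.2 α ⟨J, h⟩ else 0)
  have hjz : jetOf r u z.1 = z := by
    refine Prod.ext rfl ?_
    funext α J
    exact (hJ α J.1 J.2).trans (dif_pos J.2)
  have hc : Continuous (jetOf r u) := by
    rw [← continuousOn_univ]
    exact continuousOn_jetOf isOpen_univ (fun α => (hu α).contDiffOn) r
  obtain ⟨ρ, hρ, hball⟩ := Metric.isOpen_iff.1 hW z hz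
  have hpre : jetOf r u ⁻¹' Metric.ball z ρ ∈ 𝓝 z.1 :=
    hc.continuousAt.preimage_mem_nhds (by rw [hjz]; exact Metric.ball_mem_nhds z hρ)
  obtain ⟨δ, hδ, hball'⟩ := Metric.mem_nhds_iff.1 hpre
  have hsub : Metric.ball z.1 (min δ ρ) ×ˢ Metric.ball z.2 ρ ⊆ Metric.ball z ρ := by
    rw [← ball_prod_same z.1 z.2]
    exact prod_mono (Metric.ball_subset_ball (min_le_right _ _)) subset_rfl
  have hne : (Metric.ball z.2 ρ).Nonempty := ⟨_, Metric.mem_ball_self hρ⟩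
  refine ⟨Metric.ball z.1 (min δ ρ) ×ˢ Metric.ball z.2 ρ,
    Metric.isOpen_ball.prod Metric.isOpen_ball,
    ⟨Metric.mem_ball_self (lt_min hδ hρ), Metric.mem_ball_self hρ⟩, hsub.trans hball,
    z.1, u, ?_, fun α => (hu α).contDiffOn, fun y hy => ?_⟩
  · rw [fst_image_prod _ hne]
    exact (convex_ball z.1 (min δ ρ)).starConvex (Metric.mem_ball_self (lt_min hδ hρ))
  · refine ((convex_ball z.1 _).prod (convex_ball z.2 _)).segment_subset ⟨hy.1, ?_⟩ hy
    have h1 : jetOf r u y.1 ∈ Metric.ball z ρ :=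
      hball' (Metric.ball_subset_ball (min_le_left _ _) hy.1)
    rw [← ball_prod_same z.1 z.2] at h1
    exact h1.2

end

end ApproxCL

theorem theorem1 {n m q r p : ℕ} (hn : 0 < n)
    (D W : Set (Jet n m r)) (hD : IsOpen D) (hW : IsOpen W) (hWD : W ⊆ D)
    (Δ Λ : Fin q → Jet n m r × ℝ → ℝ)
    (hΔ : ∀ ν, SmoothNearZero D (Δ ν)) (hΛ : ∀ ν, SmoothNearZero W (Λ ν))
    (hns : NonSingular p D W Δ) :
    (LocallyYieldsConservationLaw p W Δ Λ ↔ EulerCondition p W Δ Λ) ∧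
    (StarShapedDomain W →
      (YieldsConservationLaw p D W Δ Λ ↔ EulerCondition p W Δ Λ)) := by
  have hΔW : ∀ ν, SmoothNearZero W (Δ ν) := fun ν => (hΔ ν).mono hWD
  rw [eulerCondition_iff hW hΔW hΛ]
  refine ⟨⟨fun h k hk α z hz => ?_, fun h z hz => ?_⟩,
    fun hstar => ⟨fun h k hk α => ?_, fun h => ?_⟩⟩
  · obtain ⟨W', hW', hzW', hsub, hY⟩ := h _ hz
    exact approxEuler_combCoeff_eq_zero hW' (fun ν => (hΔW ν).mono hsub)
      (fun ν => (hΛ ν).mono hsub) hY hk α hzW'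
  · obtain ⟨W', hW', hzW', hsub, hstar⟩ := exists_starShaped_nhds hW hz
    exact ⟨W', hW', hzW', hsub, yieldsConservationLaw_of_starShaped hn hW'
      (fun ν => (hΔW ν).mono hsub) (fun ν => (hΛ ν).mono hsub)
      (fun V u hu => hu.admissible.jet_mem) hstar fun k hk α z hz => h k hk α (hsub hz)⟩
  · exact approxEuler_combCoeff_eq_zero hW hΔW hΛ h hk α
  · exact yieldsConservationLaw_of_starShaped hn hW hΔW hΛ hns hstar h
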